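/- Let $\pi$ be an $n\times n$ partial permutation matrix (entries in $\{0,1\}$, at most one $1$ in each row and in each column). Let $B_-$, $B_+$ be the groups of invertible lower, resp. upper, triangular complex $n\times n$ matrices, $T=B_-\cap B_+$ the diagonal torus, and let $\overline X_\pi:=\overline{B_-\,\pi\,B_+}\subseteq M_n(\mathbb C)$ be the matrix Schubert variety of $\pi$. The Rothe diagram of $\pi$ is the set of boxes $(a,b)\in[n]\times[n]$ that remain when, for every $1$ of $\pi$, that box and all boxes due South and due East of it are removed. Let $G_\pi=[\overline X_\pi]\in H^*_{T\times T}(M_n(\mathbb C))\cong\mathbb Z[x_1,\dots,x_n,y_1,\dots,y_n]$ be the $(T\times T)$-equivariant class of $\overline X_\pi$, normalised so that $[\{m_{ab}=0\}]=x_a-y_b$ and the variables have degree $1$. Explicitly, it is given as the multidegree: let $H(T,S)$ be the Hilbert series of the coordinate ring of $\overline X_\pi$, multigraded with $m_{ab}$ of degree $T_aS_b$. Then $K:=H\cdot\prod_{a,b}(1-T_aS_b)$ is a polynomial, and $G_\pi$ is the nonzero homogeneous component of lowest degree of the polynomial obtained from $K$ by the substitution $T_a=1-x_a$, $S_b=1+y_b$.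 Then the following hold. 1. The Zariski tangent space $T_\pi\overline X_\pi\subseteq M_n(\mathbb C)$ is invariant under the action $(t,s)\cdot M=tMs^{-1}$ of $T\times T$, and it is spanned by the matrix units $E_{ab}$ with $(a,b)$ not in the Rothe diagram of $\pi$. 2. $G_\pi$ is a nonzero homogeneous polynomial, and its degree $\deg G_\pi$ is the number of boxes of the Rothe diagram of $\pi$. 3. This number is $\min\{\ell(\rho)\}$, where $\rho$ runs over the permutations of $[m]$, $m\ge n$, whose permutation matrix has $\pi$ as its Northwest $n\times n$ corner, and $\ell(\rho)$ is the number of inversions of $\rho$ (the minimum is attained). -/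

import Mathlib

namespace MatrixSchubert

/-! ### Partial permutations, Rothe diagrams, lengths

An `n × n` partial permutation matrix is encoded by `π : Fin n ≃. Fin n`; the matrix
`π.toMatrix` has entry `1` at `(i, j)` if `j ∈ π i` (that is, `π i = some j`), and `0` elsewhere. -/

/-- The Rothe diagram of a partial permutation matrix: from every `1` of the matrix cross out
that box and all the boxes due South and due East of it; the diagram consists of the boxes
that are left. -/
def rotheDiagram {n : ℕ} (π : Fin n ≃. Fin n) : Finset (Fin n × Fin n) :=
  Finset.univ.filter fun p => (∀ j ≤ p.2, j ∉ π p.1) ∧ (∀ i ≤ p.1, p.2 ∉ π i)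

/-- The number of inversions of a permutation. -/
def length {m : ℕ} (ρ : Equiv.Perm (Fin m)) : ℕ :=
  (Finset.univ.filter fun p : Fin m × Fin m => p.1 < p.2 ∧ ρ p.2 < ρ p.1).card

/-- The Northwest `n × n` corner of the permutation matrix of `ρ` is the partial permutation
matrix `π`. -/
def HasNWCorner {n m : ℕ} (h : n ≤ m) (ρ : Equiv.Perm (Fin m)) (π : Fin n ≃. Fin n) : Prop :=
  ∀ i j : Fin n, ρ (Fin.castLE h i) = Fin.castLE h j ↔ j ∈ π i

/-! ### Matrix Schubert varieties -/

/-- The group `B₋` of invertible lower triangular complex matrices. -/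
def lowerBorel (n : ℕ) : Set (Matrix (Fin n) (Fin n) ℂ) :=
  {L | IsUnit L ∧ ∀ i j, i < j → L i j = 0}

/-- The group `B₊` of invertible upper triangular complex matrices. -/
def upperBorel (n : ℕ) : Set (Matrix (Fin n) (Fin n) ℂ) :=
  {U | IsUnit U ∧ ∀ i j, j < i → U i j = 0}

/-- The complex matrix of a partial permutation. -/
def permMatrix {n : ℕ} (π : Fin n ≃. Fin n) : Matrix (Fin n) (Fin n) ℂ :=
  π.toMatrix

/-- The matrix Schubert variety: the closure of `B₋ π B₊` in the space of `n × n` complex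
matrices. -/
def matrixSchubertVariety {n : ℕ} (π : Fin n ≃. Fin n) : Set (Matrix (Fin n) (Fin n) ℂ) :=
  closure {M | ∃ L ∈ lowerBorel n, ∃ U ∈ upperBorel n, M = L * permMatrix π * U}

/-- The value of a polynomial in the matrix entries `m_{ij}` at a matrix. -/
noncomputable def evalAt {n : ℕ} (M : Matrix (Fin n) (Fin n) ℂ) :
    MvPolynomial (Fin n × Fin n) ℂ →+* ℂ :=
  MvPolynomial.eval fun p => M p.1 p.2

/-- The ideal of the polynomials in the matrix entries that vanish on a set of matrices. -/
noncomputable def idealOf {n : ℕ} (X : Set (Matrix (Fin n) (Fin n) ℂ)) :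
    Ideal (MvPolynomial (Fin n × Fin n) ℂ) where
  carrier := {f | ∀ M ∈ X, evalAt M f = 0}
  zero_mem' := fun M _ => map_zero (evalAt M)
  add_mem' := fun {f g} hf hg M hM => by rw [map_add, hf M hM, hg M hM, add_zero]
  smul_mem' := fun c f hf M hM => by rw [smul_eq_mul, map_mul, hf M hM, mul_zero]

/-- The Zariski tangent space at the point `P` of the (reduced) subvariety `X`: the common kernel
of the differentials at `P` of the polynomials in the ideal of `X`. -/
noncomputable def tangentSpace {n : ℕ} (X : Set (Matrix (Fin n) (Fin n) ℂ))
    (P : Matrix (Fin n) (Fin n) ℂ) : Submodule ℂ (Matrix (Fin n) (Fin n) ℂ) where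
  carrier := {Z | ∀ f ∈ idealOf X,
    ∑ p : Fin n × Fin n, evalAt P (MvPolynomial.pderiv p f) * Z p.1 p.2 = 0}
  zero_mem' := fun f _ => by simp
  add_mem' := fun {Y Z} hY hZ f hf => by
    simp only [Matrix.add_apply, mul_add, Finset.sum_add_distrib, hY f hf, hZ f hf, add_zero]
  smul_mem' := fun c Z hZ f hf => by
    have h := hZ f hf
    simp only [Matrix.smul_apply, smul_eq_mul, mul_left_comm _ c, ← Finset.mul_sum, h, mul_zero]

/-! ### Torus-equivariant classes as multidegrees

The torus `T × T` of pairs of invertible diagonal matrices acts on matrices by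
`(t, s) • M = t M s⁻¹`.  Its equivariant cohomology ring (of a point, equivalently of the vector
space of matrices) is `ℤ[x₁,…,xₙ,y₁,…,yₙ]`, here `MvPolynomial (Fin n ⊕ Fin n) ℤ` with
`x_a = X (inl a)` and `y_b = X (inr b)`, and the class of the hyperplane `m_{ab} = 0`
is `x_a - y_b`.

The class of an invariant subvariety `X` is given by its multidegree.  The equivariant `K`-class
of the structure sheaf of `X` is the `K`-polynomial, i.e. the numerator of the multigraded Hilbert
series of the coordinate ring; and the cohomology class is the term of lowest degree of
its Chern character.

The row variable `T_a = X (inl a)` of the Hilbert series stands for the character `exp (-x_a)`, the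
column variable `S_b = X (inr b)` for `exp (y_b)`, so that the coordinate function `m_{ab}` has the
degree of the monomial `T_a S_b`.  -/

/-- The multidegree of the coordinate function `m_{ab}`: row degree `a`, column degree `b`. -/
noncomputable def entryWeight (n : ℕ) (p : Fin n × Fin n) : (Fin n ⊕ Fin n) →₀ ℕ :=
  Finsupp.single (Sum.inl p.1) 1 + Finsupp.single (Sum.inr p.2) 1

/-- The multigraded Hilbert series of the coordinate ring of `X`: the coefficient at `d` is the
dimension of the image in the coordinate ring of the space of polynomials of multidegree `d`. -/
noncomputable def hilbertSeries {n : ℕ} (X : Set (Matrix (Fin n) (Fin n) ℂ)) :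
    MvPowerSeries (Fin n ⊕ Fin n) ℤ :=
  fun d => (Module.finrank ℂ
    ((MvPolynomial.weightedHomogeneousSubmodule ℂ (entryWeight n) d).map
      (Ideal.Quotient.mkₐ ℂ (idealOf X)).toLinearMap) : ℤ)

/-- The numerator of the Hilbert series over the denominator `∏_{a,b} (1 - T_a S_b)`, that
is, over the Hilbert series of the ring of all polynomials in the matrix entries. -/
noncomputable def kSeries {n : ℕ} (X : Set (Matrix (Fin n) (Fin n) ℂ)) :
    MvPowerSeries (Fin n ⊕ Fin n) ℤ :=
  hilbertSeries X * ∏ p : Fin n × Fin n,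
    (1 - MvPowerSeries.X (Sum.inl p.1) * MvPowerSeries.X (Sum.inr p.2))

/-- The substitution `T_a ↦ 1 - x_a`, `S_b ↦ 1 + y_b`, that is, `exp (-x_a)` and `exp (y_b)` to
first order (the terms of higher order do not affect the lowest-degree part of the result). -/
noncomputable def toCohomology (n : ℕ) :
    MvPolynomial (Fin n ⊕ Fin n) ℤ →ₐ[ℤ] MvPolynomial (Fin n ⊕ Fin n) ℤ :=
  MvPolynomial.aeval (Sum.elim
    (fun a => 1 - MvPolynomial.X (Sum.inl a))
    (fun b => 1 + MvPolynomial.X (Sum.inr b)))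

/-- The nonzero homogeneous component of lowest degree of a polynomial (`0` for `0`). -/
noncomputable def lowestPart {σ : Type*} (f : MvPolynomial σ ℤ) : MvPolynomial σ ℤ :=
  MvPolynomial.homogeneousComponent
    (sInf {d : ℕ | MvPolynomial.homogeneousComponent d f ≠ 0}) f

open Classical in
/-- The `(T × T)`-equivariant class (multidegree) of an invariant subvariety of the space of
`n × n` matrices. The numerator of the Hilbert series of an invariant subvariety is a polynomial;
for other sets, where it may fail to be one, the value is `0`. -/
noncomputable def equivariantClass {n : ℕ} (X : Set (Matrix (Fin n) (Fin n) ℂ)) :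
    MvPolynomial (Fin n ⊕ Fin n) ℤ :=
  if h : ∃ K : MvPolynomial (Fin n ⊕ Fin n) ℤ,
      (K : MvPowerSeries (Fin n ⊕ Fin n) ℤ) = kSeries X
  then lowestPart (toCohomology n h.choose)
  else 0

/-- The matrix Schubert class `G_π`: the equivariant class of the matrix Schubert variety. -/
noncomputable def matrixSchubertClass {n : ℕ} (π : Fin n ≃. Fin n) :
    MvPolynomial (Fin n ⊕ Fin n) ℤ :=
  equivariantClass (matrixSchubertVariety π)

end MatrixSchubert

/-!
The variety `X` is the closure of `B₋ π B₊`; let `D` be the Rothe diagram of `π`, let `E` be its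
complement and `I` the ideal of `X`.

*Equations and a chart.* For a box `p` of `D` only the ones of `π` strictly Northwest of `p`
contribute to the entries of `L π U` weakly Northwest of `p`. So the minor on the rows and columns
of these ones, bordered by the row and column of `p`, vanishes on `X` (`borderedMinor_mem_idealOf`).
Its differential at `π` is the coordinate `m_p`, which bounds the tangent space from above; the
lines `π + t E_p` for `p ∈ E` lie in `X` and bound it from below. Moreover, near `π` the bordered minors
express the entries in `D` through those in `E` (`eq_of_eq_off_rotheDiagram`). The polynomial map
`chart` sends `ℂ^E` into `X`, and followed by the projection to the entries in `E` it is a local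
homeomorphism, by the inverse function theorem. Therefore the chart is dominant
(`mem_idealOf_of_chartHom_eq_zero`), and the coordinates in `E` are algebraically independent on `X`
(`eq_zero_of_rename_mem_idealOf`).

*The degree of the class.* Since `I` is homogeneous for the grading by `T × T`, the Hilbert series
counts, by weight, the standard monomials of `I` for any monomial order (`finrank_map_mkₐ`). Their
exponents form a lower set, which is a finite disjoint union of cells `c + ℕ^F`
(`exists_isCellPartition`). A cell contributes `X^c ∏_{p ∉ F} (1 - T_a S_b)` to the numerator, whose
lowest term after the substitution is `∏_{p ∉ F} (x_a - y_b)`. These lowest terms are positive at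
`x = 1`, `y = 0`, so those of least degree do not cancel, and the degree of the class is `n²` minus
the largest `|F|`. The variables in `F` are algebraically independent on `X`, so the dominant chart
gives `|F| ≤ |E|` (`card_le_of_cell_subset`). If the monomial order eliminates the variables in `D`,
then `I` has no leading monomial in the variables `E`, because `I` contains no nonzero polynomial in
them (`cell_subset_standardMonomials`); so some `F` contains `E`. The degree is `n² - |E| = |D|`.

*Lengths.* If `ρ` has Northwest corner `π`, the box `(a, b)` of `D` gives the inversion
`a < ρ⁻¹ b` of `ρ`. The extension of `π` that fills the missing rows and columns in increasing order
has no other inversions (`exists_extension`).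
-/

namespace MatrixSchubert

section geometry

open Matrix Filter Topology

variable {n : ℕ}

/-! ### The closed orbit under triangular matrices -/

lemma continuous_evalAt (f : MvPolynomial (Fin n × Fin n) ℂ) :
    Continuous fun M : Matrix (Fin n) (Fin n) ℂ => evalAt M f := by
  unfold evalAt
  exact (MvPolynomial.continuous_eval f).comp (by fun_prop)

lemma eventually_isUnit_add_smul_one (M : Matrix (Fin n) (Fin n) ℂ)
    (h : ∀ ε : ℂ, (M + ε • (1 : Matrix (Fin n) (Fin n) ℂ)).det = ∏ i, (M i i + ε)) :
    ∀ᶠ ε in 𝓝[≠] (0 : ℂ), IsUnit (M + ε • (1 : Matrix (Fin n) (Fin n) ℂ)) := by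
  have key : ∀ i, ∀ᶠ ε in 𝓝[≠] (0 : ℂ), M i i + ε ≠ 0 := by
    intro i
    by_cases hi : M i i = 0
    · filter_upwards [self_mem_nhdsWithin] with ε hε
      simpa [hi] using hε
    · have hc : ContinuousAt (fun ε : ℂ => M i i + ε) 0 := by fun_prop
      exact (hc.eventually_ne (by simpa using hi)).filter_mono nhdsWithin_le_nhds
  filter_upwards [eventually_all.2 key] with ε hε
  rw [Matrix.isUnit_iff_isUnit_det, h, isUnit_iff_ne_zero]
  exact Finset.prod_ne_zero_iff.2 fun i _ => hε i

lemma blockTriangular_add_smul_one {α : Type*} [LinearOrder α] {b : Fin n → α}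
    {M : Matrix (Fin n) (Fin n) ℂ} (h : M.BlockTriangular b) (ε : ℂ) :
    (M + ε • (1 : Matrix (Fin n) (Fin n) ℂ)).BlockTriangular b :=
  h.add fun i j hij => by
    have : i ≠ j := by rintro rfl; exact lt_irrefl _ hij
    simp [this]

/-- In the closure the triangular factors may be singular, being limits of invertible ones. -/
lemma mul_permMatrix_mul_mem (π : Fin n ≃. Fin n) {L U : Matrix (Fin n) (Fin n) ℂ}
    (hL : L.IsLowerTriangular) (hU : U.IsUpperTriangular) :
    L * permMatrix π * U ∈ matrixSchubertVariety π := by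
  have h1 := eventually_isUnit_add_smul_one L fun ε => by
    rw [Matrix.det_of_isLowerTriangular _ (blockTriangular_add_smul_one hL ε)]; simp
  have h2 := eventually_isUnit_add_smul_one U fun ε => by
    rw [Matrix.det_of_isUpperTriangular (blockTriangular_add_smul_one hU ε)]; simp
  have hc : Continuous fun ε : ℂ => (L + ε • (1 : Matrix (Fin n) (Fin n) ℂ)) * permMatrix π *
      (U + ε • (1 : Matrix (Fin n) (Fin n) ℂ)) := by fun_prop
  have ht : Tendsto (fun ε : ℂ => (L + ε • (1 : Matrix (Fin n) (Fin n) ℂ)) * permMatrix π *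
      (U + ε • (1 : Matrix (Fin n) (Fin n) ℂ))) (𝓝[≠] 0) (𝓝 (L * permMatrix π * U)) := by
    have := (hc.tendsto 0).mono_left (nhdsWithin_le_nhds (s := {0}ᶜ))
    simpa using this
  refine mem_closure_of_tendsto ht ?_
  filter_upwards [h1, h2] with ε hε1 hε2
  exact ⟨_, ⟨hε1, fun i j hij => blockTriangular_add_smul_one hL ε hij⟩,
    _, ⟨hε2, fun i j hij => blockTriangular_add_smul_one hU ε hij⟩, rfl⟩

lemma mem_idealOf_iff (π : Fin n ≃. Fin n) (f : MvPolynomial (Fin n × Fin n) ℂ) :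
    f ∈ idealOf (matrixSchubertVariety π) ↔
      ∀ L U : Matrix (Fin n) (Fin n) ℂ, L.IsLowerTriangular →
        U.IsUpperTriangular → evalAt (L * permMatrix π * U) f = 0 := by
  constructor
  · intro hf L U hL hU
    exact hf _ (mul_permMatrix_mul_mem π hL hU)
  · intro h M hM
    have hcl : IsClosed {M : Matrix (Fin n) (Fin n) ℂ | evalAt M f = 0} :=
      isClosed_singleton.preimage (continuous_evalAt f)
    refine closure_minimal ?_ hcl hM
    rintro _ ⟨L, hL, U, hU, rfl⟩
    exact h L U (fun i j hij => hL.2 i j hij) (fun i j hij => hU.2 i j hij)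

/-- The variety is stable under all diagonal matrices, including the singular ones. -/
lemma diagonal_mul_mul_diagonal_mem (π : Fin n ≃. Fin n) (t s : Fin n → ℂ)
    {M : Matrix (Fin n) (Fin n) ℂ} (hM : M ∈ matrixSchubertVariety π) :
    diagonal t * M * diagonal s ∈ matrixSchubertVariety π := by
  have hcl : IsClosed {M : Matrix (Fin n) (Fin n) ℂ |
      diagonal t * M * diagonal s ∈ matrixSchubertVariety π} :=
    isClosed_closure.preimage (by fun_prop)
  refine closure_minimal ?_ hcl hM
  rintro _ ⟨L, hL, U, hU, rfl⟩
  have := mul_permMatrix_mul_mem π (L := diagonal t * L) (U := U * diagonal s)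
    ((blockTriangular_diagonal t).mul fun i j hij => hL.2 i j hij)
    (BlockTriangular.mul (fun i j hij => hU.2 i j hij) (blockTriangular_diagonal s))
  simpa [Matrix.mul_assoc] using this

/-! ### Restriction of polynomials to curves -/

/-- A polynomial that vanishes along the germ of a polynomial curve vanishes on the curve. -/
lemma evalAt_eq_zero_of_eventually (M : Matrix (Fin n) (Fin n) (Polynomial ℂ))
    (f : MvPolynomial (Fin n × Fin n) ℂ)
    (h : ∀ᶠ t in 𝓝 (0 : ℂ), evalAt (M.map (Polynomial.eval t)) f = 0) (t : ℂ) :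
    evalAt (M.map (Polynomial.eval t)) f = 0 := by
  have key : ∀ t, Polynomial.eval t (MvPolynomial.aeval (fun p : Fin n × Fin n => M p.1 p.2) f) =
      evalAt (M.map (Polynomial.eval t)) f := by
    intro t
    have : (Polynomial.evalRingHom t).comp
        (MvPolynomial.aeval (fun p : Fin n × Fin n => M p.1 p.2)).toRingHom =
        evalAt (M.map (Polynomial.eval t)) := by
      apply MvPolynomial.ringHom_ext <;> simp [evalAt]
    exact congrArg (fun g => g f) this
  rw [← key]
  have h0 : MvPolynomial.aeval (fun p : Fin n × Fin n => M p.1 p.2) f = 0 := by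
    apply Polynomial.eq_zero_of_infinite_isRoot
    apply infinite_of_mem_nhds (0 : ℂ)
    filter_upwards [h] with t ht
    rw [← key] at ht
    exact ht
  rw [h0, Polynomial.eval_zero]

/-- The derivative at `P` in the direction `Z`, as a functional on polynomials. -/
noncomputable def dirDeriv (P Z : Matrix (Fin n) (Fin n) ℂ) :
    MvPolynomial (Fin n × Fin n) ℂ →ₗ[ℂ] ℂ where
  toFun f := ∑ p : Fin n × Fin n, evalAt P (MvPolynomial.pderiv p f) * Z p.1 p.2
  map_add' f g := by simp [add_mul, Finset.sum_add_distrib]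
  map_smul' c f := by
    simp [evalAt, MvPolynomial.smul_eval, Finset.mul_sum, mul_assoc]

lemma dirDeriv_apply (P Z : Matrix (Fin n) (Fin n) ℂ) (f : MvPolynomial (Fin n × Fin n) ℂ) :
    dirDeriv P Z f = ∑ p : Fin n × Fin n, evalAt P (MvPolynomial.pderiv p f) * Z p.1 p.2 := rfl

lemma dirDeriv_mul (P Z : Matrix (Fin n) (Fin n) ℂ) (f g : MvPolynomial (Fin n × Fin n) ℂ) :
    dirDeriv P Z (f * g) = evalAt P f * dirDeriv P Z g + evalAt P g * dirDeriv P Z f := by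
  simp only [dirDeriv_apply, Derivation.leibniz, smul_eq_mul, map_add, map_mul, Finset.mul_sum,
    ← Finset.sum_add_distrib]
  exact Finset.sum_congr rfl fun p _ => by ring

lemma dirDeriv_X (P Z : Matrix (Fin n) (Fin n) ℂ) (p : Fin n × Fin n) :
    dirDeriv P Z (MvPolynomial.X p) = Z p.1 p.2 := by
  classical
  rw [dirDeriv_apply, Finset.sum_eq_single p]
  · simp
  · intro q _ hq
    rw [MvPolynomial.pderiv_X_of_ne hq.symm]; simp
  · simp

lemma dirDeriv_C (P Z : Matrix (Fin n) (Fin n) ℂ) (c : ℂ) :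
    dirDeriv P Z (MvPolynomial.C c) = 0 := by
  simp [dirDeriv_apply]

lemma hasDerivAt_evalAt_line (P Z : Matrix (Fin n) (Fin n) ℂ)
    (f : MvPolynomial (Fin n × Fin n) ℂ) :
    HasDerivAt (fun t : ℂ => evalAt (P + t • Z) f) (dirDeriv P Z f) 0 := by
  induction f using MvPolynomial.induction_on with
  | C c => simpa [dirDeriv_C, evalAt] using hasDerivAt_const (0 : ℂ) c
  | add f g hf hg => simpa [Pi.add_def] using hf.add hg
  | mul_X f p hf =>
    have hX : HasDerivAt (fun t : ℂ => evalAt (P + t • Z) (MvPolynomial.X p)) (Z p.1 p.2) 0 := by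
      simpa [evalAt] using ((hasDerivAt_id (0 : ℂ)).mul_const (Z p.1 p.2)).const_add (P p.1 p.2)
    rw [dirDeriv_mul, dirDeriv_X]
    simp only [map_mul]
    refine (hf.mul hX).congr_deriv ?_
    simp only [zero_smul, add_zero]
    ring

/-! ### Bordered minors -/

lemma mem_rotheDiagram {π : Fin n ≃. Fin n} {p : Fin n × Fin n} :
    p ∈ rotheDiagram π ↔ (∀ j ≤ p.2, j ∉ π p.1) ∧ (∀ i ≤ p.1, p.2 ∉ π i) := by
  simp [rotheDiagram]

lemma permMatrix_apply (π : Fin n ≃. Fin n) (i j : Fin n) :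
    permMatrix π i j = if j ∈ π i then 1 else 0 := PEquiv.toMatrix_apply π i j

/-- The positions of the ones of `π` strictly Northwest of the box `p`. -/
abbrev OnesNW (π : Fin n ≃. Fin n) (p : Fin n × Fin n) : Type :=
  {q : Fin n × Fin n // q.2 ∈ π q.1 ∧ q.1 < p.1 ∧ q.2 < p.2}

/-- The square submatrix of `M` on the rows and columns of the ones of `π` strictly Northwest
of `p`, rows and columns being indexed by the ones they contain. -/
def nwBlock (π : Fin n ≃. Fin n) (p : Fin n × Fin n) {R : Type*}
    (M : Matrix (Fin n) (Fin n) R) : Matrix (OnesNW π p) (OnesNW π p) R :=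
  of fun k l => M k.1.1 l.1.2

/-- The minor of `M` obtained by bordering `nwBlock π p M` with the row and the column of the
box `p`, written through the Schur complement. -/
def borderedMinor (π : Fin n ≃. Fin n) (p : Fin n × Fin n) {R : Type*} [CommRing R]
    (M : Matrix (Fin n) (Fin n) R) : R :=
  (nwBlock π p M).det * M p.1 p.2 -
    (fun k : OnesNW π p => M p.1 k.1.2) ⬝ᵥ
      ((nwBlock π p M).adjugate *ᵥ fun k : OnesNW π p => M k.1.1 p.2)

lemma map_borderedMinor (π : Fin n ≃. Fin n) (p : Fin n × Fin n) {R S : Type*} [CommRing R]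
    [CommRing S] (g : R →+* S) (M : Matrix (Fin n) (Fin n) R) :
    g (borderedMinor π p M) = borderedMinor π p (M.map g) := by
  have h : (nwBlock π p (M.map g)) = g.mapMatrix (nwBlock π p M) := rfl
  rw [borderedMinor, borderedMinor, h, ← RingHom.map_det, ← RingHom.map_adjugate]
  simp only [map_sub, map_mul, dotProduct, mulVec, map_sum, Matrix.map_apply,
    RingHom.mapMatrix_apply]

lemma evalAt_map_mvPolynomialX (M : Matrix (Fin n) (Fin n) ℂ) :
    (mvPolynomialX (Fin n) (Fin n) ℂ).map (evalAt M) = M := by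
  ext i j; simp [evalAt]

/-- Only the ones of `π` Northwest of a box of the Rothe diagram contribute to the entries of
`L π U` Northwest of that box. -/
lemma mul_permMatrix_mul_apply {π : Fin n ≃. Fin n} {p : Fin n × Fin n}
    (hp : p ∈ rotheDiagram π) {L U : Matrix (Fin n) (Fin n) ℂ} (hL : L.IsLowerTriangular)
    (hU : U.IsUpperTriangular) {i j : Fin n} (hi : i ≤ p.1) (hj : j ≤ p.2) :
    (L * permMatrix π * U) i j = ∑ k : OnesNW π p, L i k.1.1 * U k.1.2 j := by
  have h1 : (L * permMatrix π * U) i j =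
      ∑ q : Fin n × Fin n, if q.2 ∈ π q.1 then L i q.1 * U q.2 j else 0 := by
    simp only [mul_apply, permMatrix_apply, Finset.sum_mul]
    rw [Finset.sum_comm, ← Finset.univ_product_univ, Finset.sum_product]
    simp
  rw [h1, ← Finset.sum_filter, ← Finset.sum_subtype
    (Finset.univ.filter fun q : Fin n × Fin n => q.2 ∈ π q.1 ∧ q.1 < p.1 ∧ q.2 < p.2)
    (by simp) (fun q : Fin n × Fin n => L i q.1 * U q.2 j)]
  symm
  refine Finset.sum_subset (fun q hq => by simp_all) fun q hq hq' => ?_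
  simp only [Finset.mem_filter, Finset.mem_univ, true_and, not_and, not_lt] at hq hq'
  rw [mem_rotheDiagram] at hp
  rcases lt_or_ge i q.1 with h | h
  · rw [hL h, zero_mul]
  rcases lt_or_ge j q.2 with h' | h'
  · rw [hU h', mul_zero]
  exfalso
  have h1 : q.1 < p.1 := (h.trans hi).lt_of_ne fun he => hp.1 q.2 (h'.trans hj) (he ▸ hq)
  exact hp.2 q.1 h1.le (le_antisymm (h'.trans hj) (hq' hq h1) ▸ hq)

/-- The bordered block factors through the space on the ones strictly Northwest of `p`, so its rank
is less than its size. -/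
lemma borderedMinor_mul_permMatrix_mul {π : Fin n ≃. Fin n} {p : Fin n × Fin n}
    (hp : p ∈ rotheDiagram π) {L U : Matrix (Fin n) (Fin n) ℂ} (hL : L.IsLowerTriangular)
    (hU : U.IsUpperTriangular) : borderedMinor π p (L * permMatrix π * U) = 0 := by
  set A : Matrix (OnesNW π p) (OnesNW π p) ℂ := of fun k l => L k.1.1 l.1.1
  set C : Matrix (OnesNW π p) (OnesNW π p) ℂ := of fun k l => U k.1.2 l.1.2
  have hA : nwBlock π p (L * permMatrix π * U) = A * C := by
    ext k l
    rw [nwBlock, of_apply, mul_permMatrix_mul_apply hp hL hU k.2.2.1.le l.2.2.2.le, mul_apply]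
    rfl
  have hrow : (fun k : OnesNW π p => (L * permMatrix π * U) p.1 k.1.2) =
      (fun k : OnesNW π p => L p.1 k.1.1) ᵥ* C := by
    ext k
    simp only [mul_permMatrix_mul_apply hp hL hU le_rfl k.2.2.2.le, vecMul, dotProduct, C, of_apply]
  have hcol : (fun k : OnesNW π p => (L * permMatrix π * U) k.1.1 p.2) =
      A *ᵥ (fun k : OnesNW π p => U k.1.2 p.2) := by
    ext k
    simp only [mul_permMatrix_mul_apply hp hL hU k.2.2.1.le le_rfl, mulVec, dotProduct, A, of_apply]
  have hent : (L * permMatrix π * U) p.1 p.2 =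
      (fun k : OnesNW π p => L p.1 k.1.1) ⬝ᵥ (fun k : OnesNW π p => U k.1.2 p.2) :=
    mul_permMatrix_mul_apply hp hL hU le_rfl le_rfl
  have hprod : C * (C.adjugate * A.adjugate) * A = (A.det * C.det) • 1 := by
    rw [← Matrix.mul_assoc, Matrix.mul_assoc, adjugate_mul, mul_adjugate, smul_mul, Matrix.one_mul,
      smul_smul, mul_comm]
  rw [borderedMinor, hA, hrow, hcol, hent, adjugate_mul_distrib, ← dotProduct_mulVec,
    mulVec_mulVec, mulVec_mulVec, hprod, smul_mulVec, one_mulVec, dotProduct_smul, det_mul,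
    smul_eq_mul, sub_self]

/-- The bordered minors of the boxes of the Rothe diagram are equations of the variety. -/
lemma borderedMinor_mem_idealOf {π : Fin n ≃. Fin n} {p : Fin n × Fin n}
    (hp : p ∈ rotheDiagram π) :
    borderedMinor π p (mvPolynomialX (Fin n) (Fin n) ℂ) ∈ idealOf (matrixSchubertVariety π) := by
  rw [mem_idealOf_iff]
  intro L U hL hU
  rw [map_borderedMinor, evalAt_map_mvPolynomialX, borderedMinor_mul_permMatrix_mul hp hL hU]

lemma borderedMinor_eq_zero {π : Fin n ≃. Fin n} {p : Fin n × Fin n}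
    (hp : p ∈ rotheDiagram π) {M : Matrix (Fin n) (Fin n) ℂ}
    (hM : M ∈ matrixSchubertVariety π) : borderedMinor π p M = 0 := by
  have := borderedMinor_mem_idealOf hp M hM
  rwa [map_borderedMinor, evalAt_map_mvPolynomialX] at this

lemma nwBlock_permMatrix (π : Fin n ≃. Fin n) (p : Fin n × Fin n) :
    nwBlock π p (permMatrix π) = 1 := by
  ext k l
  rw [nwBlock, of_apply, permMatrix_apply, one_apply]
  refine if_congr ⟨fun h => ?_, fun h => h ▸ k.2.1⟩ rfl rfl
  refine Subtype.ext (Prod.ext (π.inj h l.2.1) (Option.mem_unique k.2.1 h))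

/-- A point of the variety at which the Northwest blocks are invertible is determined by its
entries outside of the Rothe diagram: the equations given by the bordered minors are solved for
the entries in the diagram from Northwest to Southeast. -/
lemma eq_of_eq_off_rotheDiagram {π : Fin n ≃. Fin n} {M N : Matrix (Fin n) (Fin n) ℂ}
    (hM : M ∈ matrixSchubertVariety π) (hN : N ∈ matrixSchubertVariety π)
    (hdet : ∀ p ∈ rotheDiagram π, (nwBlock π p M).det ≠ 0)
    (h : ∀ p ∉ rotheDiagram π, M p.1 p.2 = N p.1 p.2) : M = N := by
  suffices H : ∀ (k : ℕ) (p : Fin n × Fin n), p.1.val + p.2.val = k → M p.1 p.2 = N p.1 p.2 by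
    ext i j; exact H _ (i, j) rfl
  intro k
  induction k using Nat.strong_induction_on with
  | _ k ih =>
    intro p hk
    by_cases hp : p ∈ rotheDiagram π
    swap
    · exact h p hp
    have ih' : ∀ i j : Fin n, i ≤ p.1 → j ≤ p.2 → (i < p.1 ∨ j < p.2) → M i j = N i j := by
      intro i j hi hj hij
      refine ih _ ?_ (i, j) rfl
      simp only [Fin.lt_def, Fin.le_def] at hi hj hij ⊢
      omega
    have hb : nwBlock π p M = nwBlock π p N := by
      ext a b
      exact ih' _ _ a.2.2.1.le b.2.2.2.le (Or.inl a.2.2.1)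
    have hr : (fun k : OnesNW π p => M p.1 k.1.2) = fun k => N p.1 k.1.2 := by
      ext a; exact ih' _ _ le_rfl a.2.2.2.le (Or.inr a.2.2.2)
    have hc : (fun k : OnesNW π p => M k.1.1 p.2) = fun k => N k.1.1 p.2 := by
      ext a; exact ih' _ _ a.2.2.1.le le_rfl (Or.inl a.2.2.1)
    have e := (borderedMinor_eq_zero hp hM).trans (borderedMinor_eq_zero hp hN).symm
    rw [borderedMinor, borderedMinor, ← hb, ← hr, ← hc, sub_left_inj] at e
    exact mul_left_cancel₀ (hdet p hp) e

/-! ### The tangent space -/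

/-- The differential at `π` of the bordered minor of the box `p` is the coordinate `m_p`. -/
lemma dirDeriv_borderedMinor {π : Fin n ≃. Fin n} {p : Fin n × Fin n}
    (hp : p ∈ rotheDiagram π) (Z : Matrix (Fin n) (Fin n) ℂ) :
    dirDeriv (permMatrix π) Z (borderedMinor π p (mvPolynomialX (Fin n) (Fin n) ℂ)) =
      Z p.1 p.2 := by
  have hdet : evalAt (permMatrix π) (nwBlock π p (mvPolynomialX (Fin n) (Fin n) ℂ)).det = 1 := by
    have h : (evalAt (permMatrix π)).mapMatrix (nwBlock π p (mvPolynomialX (Fin n) (Fin n) ℂ)) =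
        nwBlock π p (permMatrix π) := by
      ext k l; simp [nwBlock, evalAt]
    rw [RingHom.map_det, h, nwBlock_permMatrix, det_one]
  have hX : ∀ i j, evalAt (permMatrix π) (MvPolynomial.X (i, j)) = permMatrix π i j := by
    intro i j; simp [evalAt]
  rw [mem_rotheDiagram] at hp
  have hr : ∀ j ≤ p.2, permMatrix π p.1 j = 0 := fun j hj => by
    rw [permMatrix_apply, if_neg (hp.1 j hj)]
  have hc : ∀ i ≤ p.1, permMatrix π i p.2 = 0 := fun i hi => by
    rw [permMatrix_apply, if_neg (hp.2 i hi)]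
  -- in the Schur complement, row and column of `p` vanish at `π`, so their product has no
  -- linear term
  simp only [borderedMinor, mvPolynomialX_apply, map_sub, dirDeriv_mul, hdet, dirDeriv_X, hX,
    hr _ le_rfl, dotProduct, mulVec, map_sum, map_mul, one_mul, zero_mul, add_zero]
  rw [sub_eq_self]
  refine Finset.sum_eq_zero fun k _ => ?_
  rw [hr _ k.2.2.2.le, zero_mul, zero_add]
  refine mul_eq_zero_of_left (Finset.sum_eq_zero fun l _ => ?_) _
  rw [hc _ l.2.2.1.le, mul_zero]

lemma single_apply_eq {m o : Type*} [DecidableEq m] [DecidableEq o] {R : Type*} [Zero R] [One R]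
    (i a : m) (j b : o) :
    (Matrix.single i j (1 : R)) a b = if i = a ∧ j = b then 1 else 0 := rfl

/-- For a box `p` East or South of a `1` of `π`, an elementary column or row operation produces
`π + t E_p`. -/
lemma permMatrix_add_smul_single_mem {π : Fin n ≃. Fin n} {p : Fin n × Fin n}
    (hp : p ∉ rotheDiagram π) (t : ℂ) :
    permMatrix π + t • Matrix.single p.1 p.2 (1 : ℂ) ∈ matrixSchubertVariety π := by
  have hor : (∃ j ≤ p.2, j ∈ π p.1) ∨ ∃ i ≤ p.1, p.2 ∈ π i := by
    rw [mem_rotheDiagram] at hp; by_contra! h; exact hp h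
  rcases hor with ⟨j, hj, hπ⟩ | ⟨i, hi, hπ⟩
  · have h1 : (1 + t • Matrix.single j p.2 (1 : ℂ) :
        Matrix (Fin n) (Fin n) ℂ).IsUpperTriangular := by
      refine blockTriangular_one.add fun a b hab => ?_
      have : ¬ (j = a ∧ p.2 = b) := by rintro ⟨rfl, rfl⟩; exact absurd hab (not_lt.2 hj)
      simp [this]
    have h2 : permMatrix π * Matrix.single j p.2 (1 : ℂ) = Matrix.single p.1 p.2 (1 : ℂ) := by
      ext a b
      have : j ∈ π a ↔ p.1 = a := ⟨fun h => (π.inj h hπ).symm, fun h => h ▸ hπ⟩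
      simp only [mul_apply, permMatrix_apply, single_apply_eq, this, mul_ite, mul_one, mul_zero,
        ite_and, Finset.sum_ite_eq, Finset.mem_univ, if_true]
      split_ifs <;> rfl
    have := mul_permMatrix_mul_mem π (blockTriangular_one (b := OrderDual.toDual)) h1
    rwa [Matrix.one_mul, Matrix.mul_add, Matrix.mul_one, Matrix.mul_smul, h2] at this
  · have h1 : (1 + t • Matrix.single p.1 i (1 : ℂ) :
        Matrix (Fin n) (Fin n) ℂ).IsLowerTriangular := by
      refine blockTriangular_one.add fun a b hab => ?_
      have : ¬ (p.1 = a ∧ i = b) := by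
        rintro ⟨rfl, rfl⟩; exact absurd (OrderDual.toDual_lt_toDual.1 hab) (not_lt.2 hi)
      simp [this]
    have h2 : Matrix.single p.1 i (1 : ℂ) * permMatrix π = Matrix.single p.1 p.2 (1 : ℂ) := by
      ext a b
      have : b ∈ π i ↔ p.2 = b := ⟨fun h => Option.mem_unique hπ h, fun h => h ▸ hπ⟩
      rw [mul_apply, Finset.sum_eq_single i (fun c _ hc => by simp [hc.symm]) (by simp)]
      simp only [permMatrix_apply, single_apply_eq, this, and_true, ite_and]
      split_ifs <;> simp
    have := mul_permMatrix_mul_mem π h1 (blockTriangular_one (b := id))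
    rwa [Matrix.mul_one, Matrix.add_mul, Matrix.one_mul, smul_mul, h2] at this

lemma mem_tangentSpace_iff (π : Fin n ≃. Fin n) (Z : Matrix (Fin n) (Fin n) ℂ) :
    Z ∈ tangentSpace (matrixSchubertVariety π) (permMatrix π) ↔
      ∀ p ∈ rotheDiagram π, Z p.1 p.2 = 0 := by
  constructor
  · intro hZ p hp
    rw [← dirDeriv_borderedMinor hp Z]
    exact hZ _ (borderedMinor_mem_idealOf hp)
  · intro hZ
    rw [matrix_eq_sum_single Z]
    refine Submodule.sum_mem _ fun i _ => Submodule.sum_mem _ fun j _ => ?_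
    by_cases hp : (i, j) ∈ rotheDiagram π
    · rw [hZ _ hp, single_zero]; exact Submodule.zero_mem _
    have h1 : Matrix.single i j (Z i j) = Z i j • Matrix.single i j (1 : ℂ) := by simp
    rw [h1]
    refine Submodule.smul_mem _ _ fun f hf => ?_
    rw [← dirDeriv_apply]
    have h2 := hasDerivAt_evalAt_line (permMatrix π) (Matrix.single i j 1) f
    have h3 : (fun t : ℂ => evalAt (permMatrix π + t • Matrix.single i j 1) f) = fun _ => 0 :=
      funext fun t => hf _ (permMatrix_add_smul_single_mem hp t)
    rw [h3] at h2
    exact h2.unique (hasDerivAt_const _ _)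

lemma tangentSpace_eq_span (π : Fin n ≃. Fin n) :
    tangentSpace (matrixSchubertVariety π) (permMatrix π) =
      Submodule.span ℂ {Z : Matrix (Fin n) (Fin n) ℂ |
        ∃ a b : Fin n, (a, b) ∉ rotheDiagram π ∧ Z = Matrix.single a b 1} := by
  apply le_antisymm
  · intro Z hZ
    rw [mem_tangentSpace_iff] at hZ
    rw [matrix_eq_sum_single Z]
    refine Submodule.sum_mem _ fun i _ => Submodule.sum_mem _ fun j _ => ?_
    by_cases hp : (i, j) ∈ rotheDiagram π
    · rw [hZ _ hp, single_zero]; exact Submodule.zero_mem _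
    have h1 : Matrix.single i j (Z i j) = Z i j • Matrix.single i j (1 : ℂ) := by simp
    rw [h1]
    exact Submodule.smul_mem _ _ (Submodule.subset_span ⟨i, j, hp, rfl⟩)
  · rw [Submodule.span_le]
    rintro _ ⟨a, b, hab, rfl⟩
    rw [SetLike.mem_coe, mem_tangentSpace_iff]
    intro p hp
    rw [single_apply_eq, if_neg]
    rintro ⟨rfl, rfl⟩
    exact hab hp

/-! ### A chart of the variety around `π` -/

/-- The boxes outside of the Rothe diagram. -/
abbrev OffDiagram (π : Fin n ≃. Fin n) : Type := {p : Fin n × Fin n // p ∉ rotheDiagram π}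

section chart

variable (π : Fin n ≃. Fin n) {R : Type*} [CommRing R]

/-- The matrix with entries `w` on the boxes outside of the Rothe diagram that lie weakly South
of a `1` of `π`, and `0` elsewhere. -/
def southPart (w : OffDiagram π → R) : Matrix (Fin n) (Fin n) R :=
  of fun i j => if h : (i, j) ∉ rotheDiagram π then
    if ∃ k ≤ i, j ∈ π k then w ⟨(i, j), h⟩ else 0 else 0

/-- The matrix with entries `w` on the boxes outside of the Rothe diagram that do not lie weakly
South of a `1` of `π` (and so lie East of one), and `0` elsewhere. -/
def eastPart (w : OffDiagram π → R) : Matrix (Fin n) (Fin n) R :=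
  of fun i j => if h : (i, j) ∉ rotheDiagram π then
    if ∃ k ≤ i, j ∈ π k then 0 else w ⟨(i, j), h⟩ else 0

/-- The polynomial map `w ↦ (1 + w_S πᵀ) π (1 + πᵀ w_E)` from the affine space on the boxes outside
of the Rothe diagram to the matrix Schubert variety; `w_S` and `w_E` are the South and East parts
of `w`. It is defined by the expanded product, in which `w_S πᵀ π = w_S` and `π πᵀ w_E = w_E`. -/
def chart (w : OffDiagram π → R) : Matrix (Fin n) (Fin n) R :=
  π.toMatrix + southPart π w + eastPart π w + southPart π w * π.toMatrixᵀ * eastPart π w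

lemma map_chart {S : Type*} [CommRing S] (g : R →+* S) (w : OffDiagram π → R) :
    (chart π w).map g = chart π (g ∘ w) := by
  have h1 : (southPart π w).map g = southPart π (g ∘ w) := by
    ext i j; simp only [southPart, map_apply, of_apply]; split_ifs <;> simp
  have h2 : (eastPart π w).map g = eastPart π (g ∘ w) := by
    ext i j; simp only [eastPart, map_apply, of_apply]; split_ifs <;> simp
  have h3 : (π.toMatrix : Matrix (Fin n) (Fin n) R).map g = π.toMatrix := by
    ext i j; simp only [PEquiv.toMatrix_apply, map_apply]; split_ifs <;> simp
  rw [chart, chart, Matrix.map_add _ (map_add g), Matrix.map_add _ (map_add g),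
    Matrix.map_add _ (map_add g), Matrix.map_mul, Matrix.map_mul, transpose_map, h1, h2, h3]

variable {π}

lemma southPart_apply_eq_zero (w : OffDiagram π → R) {i j : Fin n} (h : ¬ ∃ k ≤ i, j ∈ π k) :
    southPart π w i j = 0 := by
  simp only [southPart, of_apply, if_neg h, dite_eq_ite, ite_self]

lemma eastPart_apply_eq_zero (w : OffDiagram π → R) {i j : Fin n} (h : ¬ ∃ l ≤ j, l ∈ π i) :
    eastPart π w i j = 0 := by
  by_cases h2 : ∃ k ≤ i, j ∈ π k
  · simp only [eastPart, of_apply, if_pos h2, dite_eq_ite, ite_self]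
  · have h1 : (i, j) ∈ rotheDiagram π := mem_rotheDiagram.2
      ⟨fun k hk hk' => h ⟨k, hk, hk'⟩, fun k hk hk' => h2 ⟨k, hk, hk'⟩⟩
    rw [eastPart, of_apply, dif_neg (not_not.2 h1)]

end chart

lemma southPart_mul (π : Fin n ≃. Fin n) (w : OffDiagram π → ℂ) :
    southPart π w * (permMatrix π)ᵀ * permMatrix π = southPart π w := by
  have h : (permMatrix π)ᵀ * permMatrix π = (PEquiv.ofSet {b | (π.symm b).isSome}).toMatrix := by
    rw [permMatrix, ← PEquiv.toMatrix_symm, ← PEquiv.toMatrix_trans, PEquiv.symm_trans_self]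
  ext i j
  rw [Matrix.mul_assoc, h, mul_apply, Finset.sum_eq_single j]
  · by_cases h2 : ∃ k ≤ i, j ∈ π k
    · obtain ⟨k, -, hk⟩ := id h2
      rw [← PEquiv.mem_iff_mem] at hk
      simp [PEquiv.toMatrix_apply, Option.isSome_of_mem hk]
    · rw [southPart_apply_eq_zero w h2, zero_mul]
  · intro k _ hk
    simp [PEquiv.toMatrix_apply, hk.symm]
  · simp

lemma mul_eastPart (π : Fin n ≃. Fin n) (w : OffDiagram π → ℂ) :
    permMatrix π * ((permMatrix π)ᵀ * eastPart π w) = eastPart π w := by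
  have h : permMatrix π * (permMatrix π)ᵀ = (PEquiv.ofSet {a | (π a).isSome}).toMatrix := by
    rw [permMatrix, ← PEquiv.toMatrix_symm, ← PEquiv.toMatrix_trans, PEquiv.self_trans_symm]
  ext i j
  rw [← Matrix.mul_assoc, h, mul_apply, Finset.sum_eq_single i]
  · by_cases h2 : ∃ l ≤ j, l ∈ π i
    · obtain ⟨k, -, hk⟩ := id h2
      simp [PEquiv.toMatrix_apply, Option.isSome_of_mem hk]
    · rw [eastPart_apply_eq_zero w h2, mul_zero]
  · intro k _ hk
    simp [PEquiv.toMatrix_apply, hk]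
  · simp

lemma chart_mem (π : Fin n ≃. Fin n) (w : OffDiagram π → ℂ) :
    chart π w ∈ matrixSchubertVariety π := by
  have hL : (1 + southPart π w * (permMatrix π)ᵀ).IsLowerTriangular := by
    refine blockTriangular_one.add fun i k hik => ?_
    rw [mul_apply]
    refine Finset.sum_eq_zero fun j _ => ?_
    rw [transpose_apply, permMatrix_apply]
    by_cases hk : j ∈ π k
    · rw [southPart_apply_eq_zero, zero_mul]
      rintro ⟨k', hk', hj⟩
      exact absurd (OrderDual.toDual_lt_toDual.1 hik) (not_lt.2 (π.inj hj hk ▸ hk'))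
    · rw [if_neg hk, mul_zero]
  have hU : (1 + (permMatrix π)ᵀ * eastPart π w).IsUpperTriangular := by
    refine blockTriangular_one.add fun l j hjl => ?_
    rw [mul_apply]
    refine Finset.sum_eq_zero fun i _ => ?_
    rw [transpose_apply, permMatrix_apply]
    by_cases hi : l ∈ π i
    · rw [eastPart_apply_eq_zero, mul_zero]
      rintro ⟨l', hl', hi'⟩
      exact absurd hjl (not_lt.2 (Option.mem_unique hi' hi ▸ hl'))
    · rw [if_neg hi, zero_mul]
  have := mul_permMatrix_mul_mem π hL hU
  rw [Matrix.add_mul, Matrix.one_mul, southPart_mul, Matrix.mul_add, Matrix.mul_one, Matrix.add_mul,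
    mul_eastPart, ← Matrix.mul_assoc] at this
  convert this using 1
  rw [chart, permMatrix]
  abel

/-- Seen through the entries outside of the Rothe diagram, the chart has the identity as its
differential at the origin. -/
lemma hasStrictFDerivAt_chart (π : Fin n ≃. Fin n) :
    HasStrictFDerivAt (fun (w : OffDiagram π → ℂ) (e : OffDiagram π) => chart π w e.1.1 e.1.2)
      ((ContinuousLinearEquiv.refl ℂ (OffDiagram π → ℂ) :
        (OffDiagram π → ℂ) →L[ℂ] (OffDiagram π → ℂ))) 0 := by
  rw [hasStrictFDerivAt_pi']
  intro e
  have hS : ∀ i j, ContDiff ℂ 1 fun w : OffDiagram π → ℂ => southPart π w i j := by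
    intro i j
    simp only [southPart, of_apply]
    split_ifs <;> fun_prop
  have hE : ∀ i j, ContDiff ℂ 1 fun w : OffDiagram π → ℂ => eastPart π w i j := by
    intro i j
    simp only [eastPart, of_apply]
    split_ifs <;> fun_prop
  have hSπ : ∀ i j,
      ContDiff ℂ 1 fun w : OffDiagram π → ℂ => (southPart π w * (permMatrix π)ᵀ) i j := by
    intro i j
    simp only [mul_apply]
    fun_prop
  have hS0 : southPart π (0 : OffDiagram π → ℂ) = 0 := by
    ext i j; simp [southPart]
  have hE0 : eastPart π (0 : OffDiagram π → ℂ) = 0 := by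
    ext i j; simp [eastPart]
  have hlin : HasStrictFDerivAt (fun w : OffDiagram π → ℂ => w e)
      (ContinuousLinearMap.proj (R := ℂ) (φ := fun _ : OffDiagram π => ℂ) e) 0 :=
    (ContinuousLinearMap.proj (R := ℂ) (φ := fun _ : OffDiagram π => ℂ) e).hasStrictFDerivAt
  have hquad : HasStrictFDerivAt (fun w : OffDiagram π → ℂ =>
      ∑ c, (southPart π w * (permMatrix π)ᵀ) e.1.1 c * eastPart π w c e.1.2)
      (∑ _c : Fin n, (0 : (OffDiagram π → ℂ) →L[ℂ] ℂ)) 0 := by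
    refine HasStrictFDerivAt.fun_sum fun c _ => ?_
    have h1 := (hSπ e.1.1 c).contDiffAt.hasStrictFDerivAt (x := 0) one_ne_zero
    have h2 := (hE c e.1.2).contDiffAt.hasStrictFDerivAt (x := 0) one_ne_zero
    refine (h1.fun_mul h2).congr_fderiv ?_
    ext v
    simp [hS0, hE0]
  have := (hlin.add hquad).const_add (permMatrix π e.1.1 e.1.2)
  refine (this.congr_fderiv ?_).congr_of_eventuallyEq (Eventually.of_forall fun w => ?_)
  · ext; simp
  · have : southPart π w e.1.1 e.1.2 + eastPart π w e.1.1 e.1.2 = w e := by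
      simp only [southPart, eastPart, of_apply]
      rw [dif_pos e.2, dif_pos e.2]
      split_ifs <;> simp
    change _ = permMatrix π e.1.1 e.1.2 + southPart π w e.1.1 e.1.2 + eastPart π w e.1.1 e.1.2 +
      (southPart π w * (permMatrix π)ᵀ * eastPart π w) e.1.1 e.1.2
    simp only [Pi.add_apply]
    rw [mul_apply (M := southPart π w * (permMatrix π)ᵀ), ← this]
    ring

lemma map_chart_nhds (π : Fin n ≃. Fin n) :
    map (fun (w : OffDiagram π → ℂ) (e : OffDiagram π) => chart π w e.1.1 e.1.2) (𝓝 0) =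
      𝓝 fun e : OffDiagram π => permMatrix π e.1.1 e.1.2 := by
  rw [(hasStrictFDerivAt_chart π).map_nhds_eq_of_equiv]
  congr 1
  have hS0 : southPart π (0 : OffDiagram π → ℂ) = 0 := by
    ext i j; simp [southPart]
  have hE0 : eastPart π (0 : OffDiagram π → ℂ) = 0 := by
    ext i j; simp [eastPart]
  simp [chart, hS0, hE0, permMatrix]

/-- The pullback of polynomials along the chart. -/
noncomputable def chartHom (π : Fin n ≃. Fin n) :
    MvPolynomial (Fin n × Fin n) ℂ →ₐ[ℂ] MvPolynomial (OffDiagram π) ℂ :=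
  MvPolynomial.aeval fun p =>
    chart π (MvPolynomial.X : OffDiagram π → MvPolynomial (OffDiagram π) ℂ) p.1 p.2

lemma eval_chartHom (π : Fin n ≃. Fin n) (w : OffDiagram π → ℂ)
    (f : MvPolynomial (Fin n × Fin n) ℂ) :
    MvPolynomial.eval w (chartHom π f) = evalAt (chart π w) f := by
  have h : chart π w =
      (chart π (MvPolynomial.X : OffDiagram π → MvPolynomial (OffDiagram π) ℂ)).map
        (MvPolynomial.eval w) := by
    rw [map_chart]; congr 1; ext e : 1; simp
  have : (MvPolynomial.eval w).comp (chartHom π).toRingHom = evalAt (chart π w) := by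
    rw [h, chartHom]
    apply MvPolynomial.ringHom_ext <;> simp [evalAt]
  exact congrArg (fun g => g f) this

/-- The chart is dominant: near `π`, a point `L π U` is the point of the chart that has the same
entries outside of the Rothe diagram. -/
lemma mem_idealOf_of_chartHom_eq_zero {π : Fin n ≃. Fin n} {f : MvPolynomial (Fin n × Fin n) ℂ}
    (hf : chartHom π f = 0) : f ∈ idealOf (matrixSchubertVariety π) := by
  rw [mem_idealOf_iff]
  intro L U hL hU
  -- the curve of the points `(1 + t (L - 1)) π (1 + t (U - 1))`, from `π` to `L π U`
  set M : Matrix (Fin n) (Fin n) (Polynomial ℂ) :=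
    (1 + (Polynomial.X : Polynomial ℂ) • (L - 1).map Polynomial.C) *
      (permMatrix π).map Polynomial.C *
      (1 + (Polynomial.X : Polynomial ℂ) • (U - 1).map Polynomial.C) with hM
  have hMt : ∀ t : ℂ, M.map (Polynomial.eval t) =
      (1 + t • (L - 1)) * permMatrix π * (1 + t • (U - 1)) := by
    intro t
    have h1 : ∀ N : Matrix (Fin n) (Fin n) ℂ,
        (N.map Polynomial.C).map (Polynomial.evalRingHom t) = N := by
      intro N; ext i j; simp
    have h2 : ∀ N : Matrix (Fin n) (Fin n) ℂ,
        (1 + (Polynomial.X : Polynomial ℂ) • N.map Polynomial.C).map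
        (Polynomial.evalRingHom t) = 1 + t • N := by
      intro N; ext i j; by_cases hij : i = j <;> simp [hij] <;> ring
    change M.map (Polynomial.evalRingHom t) = _
    rw [hM, Matrix.map_mul, Matrix.map_mul, h1, h2, h2]
  have hcont : Continuous fun t : ℂ => (1 + t • (L - 1)) * permMatrix π * (1 + t • (U - 1)) := by
    fun_prop
  have h0 : (1 + (0 : ℂ) • (L - 1)) * permMatrix π * (1 + (0 : ℂ) • (U - 1)) = permMatrix π := by
    simp
  have hdet : ∀ᶠ t in 𝓝 (0 : ℂ), ∀ p : Fin n × Fin n,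
      (nwBlock π p ((1 + t • (L - 1)) * permMatrix π * (1 + t • (U - 1)))).det ≠ 0 := by
    rw [eventually_all]
    intro p
    have hc : Continuous fun t : ℂ =>
        (nwBlock π p ((1 + t • (L - 1)) * permMatrix π * (1 + t • (U - 1)))).det := by
      refine Continuous.matrix_det (continuous_matrix fun i j => ?_)
      exact hcont.matrix_elem _ _
    refine hc.continuousAt.eventually_ne ?_
    rw [h0, nwBlock_permMatrix, det_one]
    exact one_ne_zero
  have hnear : ∀ᶠ t in 𝓝 (0 : ℂ), ∃ w : OffDiagram π → ℂ,
      (fun e : OffDiagram π => chart π w e.1.1 e.1.2) =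
        fun e : OffDiagram π =>
          ((1 + t • (L - 1)) * permMatrix π * (1 + t • (U - 1))) e.1.1 e.1.2 := by
    have hr : Set.range (fun (w : OffDiagram π → ℂ) (e : OffDiagram π) =>
        chart π w e.1.1 e.1.2) ∈ 𝓝 fun e : OffDiagram π => permMatrix π e.1.1 e.1.2 := by
      rw [← map_chart_nhds]; exact range_mem_map
    have hc : Tendsto (fun (t : ℂ) (e : OffDiagram π) =>
        ((1 + t • (L - 1)) * permMatrix π * (1 + t • (U - 1))) e.1.1 e.1.2) (𝓝 0)
        (𝓝 fun e : OffDiagram π => permMatrix π e.1.1 e.1.2) := by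
      have : Continuous (fun (t : ℂ) (e : OffDiagram π) =>
        ((1 + t • (L - 1)) * permMatrix π * (1 + t • (U - 1))) e.1.1 e.1.2) :=
        continuous_pi fun e => hcont.matrix_elem _ _
      have := this.tendsto 0
      rwa [h0] at this
    exact hc.eventually hr
  have hev : ∀ᶠ t in 𝓝 (0 : ℂ), evalAt (M.map (Polynomial.eval t)) f = 0 := by
    filter_upwards [hdet, hnear] with t ht1 ⟨w, hw⟩
    rw [hMt]
    have hmem := mul_permMatrix_mul_mem π
      (L := 1 + t • (L - 1)) (U := 1 + t • (U - 1))
      (blockTriangular_one.add fun i j hij => by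
        rw [Matrix.smul_apply, (hL.sub blockTriangular_one) hij, smul_zero])
      (blockTriangular_one.add fun i j hij => by
        rw [Matrix.smul_apply, (hU.sub blockTriangular_one) hij, smul_zero])
    rw [eq_of_eq_off_rotheDiagram hmem (chart_mem π w) (fun p _ => ht1 p)
      fun p hp => (congrFun hw ⟨p, hp⟩).symm, ← eval_chartHom, hf, map_zero]
  have := evalAt_eq_zero_of_eventually M f hev 1
  rw [hMt] at this
  simpa using this

/-- The coordinates outside of the Rothe diagram are algebraically independent on the variety. -/
lemma eq_zero_of_rename_mem_idealOf {π : Fin n ≃. Fin n} {g : MvPolynomial (OffDiagram π) ℂ}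
    (hg : MvPolynomial.rename Subtype.val g ∈ idealOf (matrixSchubertVariety π)) : g = 0 := by
  have hr : ∀ᶠ v in 𝓝 (fun e : OffDiagram π => permMatrix π e.1.1 e.1.2),
      MvPolynomial.eval v g = 0 := by
    rw [← map_chart_nhds, eventually_map]
    refine Eventually.of_forall fun w => ?_
    have := hg _ (chart_mem π w)
    rwa [evalAt, MvPolynomial.eval_rename] at this
  rw [eventually_iff, nhds_pi, mem_pi] at hr
  obtain ⟨I, -, t, ht, hI⟩ := hr
  refine MvPolynomial.funext_set t (fun i => infinite_of_mem_nhds _ (ht i)) fun x hx => ?_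
  rw [map_zero]
  exact hI fun i _ => hx i trivial

/-- The ideal is homogeneous for the grading by `T × T`. -/
lemma weightedHomogeneousComponent_mem_idealOf {π : Fin n ≃. Fin n}
    {f : MvPolynomial (Fin n × Fin n) ℂ} (hf : f ∈ idealOf (matrixSchubertVariety π))
    (d : (Fin n ⊕ Fin n) →₀ ℕ) :
    MvPolynomial.weightedHomogeneousComponent (entryWeight n) d f ∈
      idealOf (matrixSchubertVariety π) := by
  classical
  intro M hM
  -- the polynomial `f(t M s)` in the torus variables has the values of the components of `f`
  -- at `M` as its coefficients
  set G : MvPolynomial (Fin n × Fin n) ℂ →ₐ[ℂ] MvPolynomial (Fin n ⊕ Fin n) ℂ :=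
    MvPolynomial.aeval fun p => MvPolynomial.monomial (entryWeight n p) (M p.1 p.2) with hG
  have h0 : G f = 0 := by
    refine MvPolynomial.funext fun v => ?_
    have h1 : (MvPolynomial.eval v).comp G.toRingHom =
        evalAt (diagonal (fun i => v (Sum.inl i)) * M * diagonal (fun j => v (Sum.inr j))) := by
      apply MvPolynomial.ringHom_ext
      · simp [evalAt]
      · intro p
        simp [hG, evalAt, MvPolynomial.eval_monomial, entryWeight, Finsupp.prod_add_index',
          pow_add]
        ring
    have h2 := congrArg (fun g => g f) h1
    simp only [RingHom.comp_apply] at h2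
    rw [map_zero]
    exact h2.trans (hf _ (diagonal_mul_mul_diagonal_mem π _ _ hM))
  have hcoeff : ∀ g, MvPolynomial.coeff d (G g) =
      evalAt M (MvPolynomial.weightedHomogeneousComponent (entryWeight n) d g) := by
    intro g
    induction g using MvPolynomial.induction_on' with
    | add p q hp hq => simp [hp, hq]
    | monomial s c =>
      have h1 : G (MvPolynomial.monomial s c) = MvPolynomial.monomial
          (Finsupp.weight (entryWeight n) s) (evalAt M (MvPolynomial.monomial s c)) := by
        rw [hG, MvPolynomial.aeval_monomial, evalAt, MvPolynomial.eval_monomial,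
          MvPolynomial.algebraMap_eq, Finsupp.weight_apply, Finsupp.prod, Finsupp.prod,
          Finsupp.sum, ← MvPolynomial.C_mul_monomial, MvPolynomial.monomial_sum_prod]
        simp only [MvPolynomial.monomial_pow]
      rw [h1, MvPolynomial.coeff_monomial, MvPolynomial.weightedHomogeneousComponent_of_mem
        (n := Finsupp.weight (entryWeight n) s)
        (MvPolynomial.isWeightedHomogeneous_monomial _ _ _ rfl), apply_ite (evalAt M), map_zero]
      exact if_congr eq_comm rfl rfl
  rw [← hcoeff, h0, MvPolynomial.coeff_zero]

end geometry

/-! ### Decomposing lower sets of exponents into cells -/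

section cells

variable {σ : Type*}

/-- The translate `c + ℕ^F` of a coordinate face of `ℕ^σ`, for `q = (c, F)`. -/
def cell (q : (σ →₀ ℕ) × Finset σ) : Set (σ →₀ ℕ) :=
  {s | q.1 ≤ s ∧ ∀ i ∉ q.2, s i = q.1 i}

lemma mem_cell {q : (σ →₀ ℕ) × Finset σ} {s : σ →₀ ℕ} :
    s ∈ cell q ↔ q.1 ≤ s ∧ ∀ i ∉ q.2, s i = q.1 i := Iff.rfl

/-- The family of cells `C` partitions `S`. -/
def IsCellPartition (C : Multiset ((σ →₀ ℕ) × Finset σ)) (S : Set (σ →₀ ℕ)) : Prop :=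
  ∀ s, (C.map fun q => (cell q).indicator (1 : (σ →₀ ℕ) → ℤ) s).sum = S.indicator 1 s

lemma IsCellPartition.add {C D : Multiset ((σ →₀ ℕ) × Finset σ)} {S T : Set (σ →₀ ℕ)}
    (hC : IsCellPartition C S) (hD : IsCellPartition D T) (hST : Disjoint S T) :
    IsCellPartition (C + D) (S ∪ T) := by
  intro s
  rw [Multiset.map_add, Multiset.sum_add, hC, hD, Set.indicator_union_of_disjoint hST]

lemma IsCellPartition.cell_subset {C : Multiset ((σ →₀ ℕ) × Finset σ)} {S : Set (σ →₀ ℕ)}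
    (hC : IsCellPartition C S) {q : (σ →₀ ℕ) × Finset σ} (hq : q ∈ C) : cell q ⊆ S := by
  intro s hs
  by_contra hS
  have h := hC s
  rw [Set.indicator_of_notMem hS] at h
  have hle := Multiset.single_le_sum (s := C.map fun q => (cell q).indicator (1 : (σ →₀ ℕ) → ℤ) s)
    (by
      intro x hx
      obtain ⟨q, -, rfl⟩ := Multiset.mem_map.1 hx
      exact Set.indicator_nonneg (fun _ _ => zero_le_one) _) _ (Multiset.mem_map_of_mem _ hq)
  rw [h, Set.indicator_of_mem hs] at hle
  exact absurd hle (by simp)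

lemma IsCellPartition.exists_mem_cell {C : Multiset ((σ →₀ ℕ) × Finset σ)} {S : Set (σ →₀ ℕ)}
    (hC : IsCellPartition C S) {s : σ →₀ ℕ} (hs : s ∈ S) : ∃ q ∈ C, s ∈ cell q := by
  by_contra! h
  have h1 := hC s
  rw [Set.indicator_of_mem hs, Multiset.map_congr rfl
    (fun q hq => Set.indicator_of_notMem (h q hq) _)] at h1
  simp at h1

lemma cell_eq_union [DecidableEq σ] (c : σ →₀ ℕ) {F : Finset σ} {i : σ} (hi : i ∈ F) :
    cell (c, F) = cell (c, F.erase i) ∪ cell (c + Finsupp.single i 1, F) := by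
  ext s
  simp only [mem_cell, Set.mem_union, Finset.mem_erase, Finsupp.le_def, Finsupp.add_apply]
  constructor
  · rintro ⟨h1, h2⟩
    rcases (h1 i).eq_or_lt with h | h
    · refine Or.inl ⟨h1, fun j hj => ?_⟩
      by_cases hji : j = i
      · rw [hji, h]
      · exact h2 j fun hjF => hj ⟨hji, hjF⟩
    · refine Or.inr ⟨fun j => ?_, fun j hj => ?_⟩
      · by_cases hji : i = j
        · subst hji; simpa using h
        · simpa [Finsupp.single_apply, hji] using h1 j
      · have : i ≠ j := by rintro rfl; exact hj hi
        simpa [Finsupp.single_apply, this] using h2 j hj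
  · rintro (⟨h1, h2⟩ | ⟨h1, h2⟩)
    · exact ⟨h1, fun j hj => h2 j fun h => hj h.2⟩
    · refine ⟨fun j => (Nat.le_add_right _ _).trans (h1 j), fun j hj => ?_⟩
      have : i ≠ j := by rintro rfl; exact hj hi
      simpa [Finsupp.single_apply, this] using h2 j hj

lemma disjoint_cell_erase [DecidableEq σ] (c : σ →₀ ℕ) (F : Finset σ) (i : σ) :
    Disjoint (cell (c, F.erase i)) (cell (c + Finsupp.single i 1, F)) := by
  rw [Set.disjoint_left]
  rintro s ⟨-, h1⟩ ⟨h2, -⟩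
  have h3 := h1 i (by simp)
  have h4 := h2 i
  simp only [Finsupp.add_apply, Finsupp.single_eq_same] at h3 h4
  omega

/-- Induction on the dimension of the cell: a cell that does not lie in the lower set `Δ` contains
a point `p ∉ Δ`, and outside of finitely many disjoint cells of smaller dimension all of its points
are above `p`, hence not in `Δ`. -/
lemma exists_isCellPartition_inter_cell {Δ : Set (σ →₀ ℕ)} (hΔ : IsLowerSet Δ) (F : Finset σ) :
    ∀ c, ∃ C, IsCellPartition C (Δ ∩ cell (c, F)) := by
  classical
  induction F using Finset.strongInduction with
  | H F ih =>
    intro c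
    by_cases hsub : cell (c, F) ⊆ Δ
    · refine ⟨{(c, F)}, fun s => ?_⟩
      rw [Set.inter_eq_right.2 hsub]; simp
    obtain ⟨p, hp, hpΔ⟩ := Set.not_subset.1 hsub
    -- cutting off a slice of smaller dimension moves the vertex of the cell one step towards `p`
    have key : ∀ (k : ℕ) (c' : σ →₀ ℕ), (∀ i ∉ F, p i ≤ c' i) → ∑ i ∈ F, (p i - c' i) = k →
        ∃ C, IsCellPartition C (Δ ∩ cell (c', F)) := by
      intro k
      induction k using Nat.strong_induction_on with
      | _ k ihk =>
        intro c' hc' hk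
        by_cases hlt : ∃ i ∈ F, c' i < p i
        · obtain ⟨i, hi, hlt⟩ := hlt
          obtain ⟨C, hC⟩ := ih (F.erase i) (Finset.erase_ssubset hi) c'
          obtain ⟨D, hD⟩ := ihk (∑ j ∈ F, (p j - (c' + Finsupp.single i 1 : σ →₀ ℕ) j)) (by
              rw [← hk]
              refine Finset.sum_lt_sum (fun j _ => ?_) ⟨i, hi, ?_⟩
              · rw [Finsupp.add_apply]; omega
              · rw [Finsupp.add_apply, Finsupp.single_eq_same]; omega)
            (c' + Finsupp.single i 1)
            (fun j hj => (hc' j hj).trans (by rw [Finsupp.add_apply]; omega)) rfl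
          refine ⟨C + D, ?_⟩
          rw [cell_eq_union c' hi, Set.inter_union_distrib_left]
          exact hC.add hD ((disjoint_cell_erase c' F i).mono Set.inter_subset_right
            Set.inter_subset_right)
        · push Not at hlt
          refine ⟨0, ?_⟩
          have : Δ ∩ cell (c', F) = ∅ := by
            rw [Set.eq_empty_iff_forall_notMem]
            rintro s ⟨hs, hs', -⟩
            refine hpΔ (hΔ (fun i => ?_) hs)
            by_cases hi : i ∈ F
            · exact (hlt i hi).trans (hs' i)
            · exact (hc' i hi).trans (hs' i)
          rw [this]
          intro s; simp
    exact key _ c (fun i hi => (hp.2 i hi).le) rfl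

/-- A Stanley decomposition: a lower set in `ℕ^σ` is a finite disjoint union of cells. -/
lemma exists_isCellPartition [Finite σ] {Δ : Set (σ →₀ ℕ)} (hΔ : IsLowerSet Δ) :
    ∃ C, IsCellPartition C Δ := by
  have := Fintype.ofFinite σ
  obtain ⟨C, hC⟩ := exists_isCellPartition_inter_cell hΔ Finset.univ 0
  refine ⟨C, ?_⟩
  have : cell ((0 : σ →₀ ℕ), Finset.univ) = Set.univ :=
    Set.eq_univ_of_forall fun s => ⟨zero_le, by simp⟩
  rwa [this, Set.inter_univ] at hC

/-- In a partition of a set that contains the face `ℕ^E`, some cell has the directions of `E`: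
the one that contains a point far out in that face. -/
lemma IsCellPartition.exists_subset {C : Multiset ((σ →₀ ℕ) × Finset σ)} {S : Set (σ →₀ ℕ)}
    (hC : IsCellPartition C S) {E : Finset σ} (hE : cell (0, E) ⊆ S) : ∃ q ∈ C, E ⊆ q.2 := by
  classical
  set s : σ →₀ ℕ := Finsupp.indicator E fun i _ => (C.map fun q => q.1 i).sum + 1 with hs
  obtain ⟨q, hq, hsq⟩ := hC.exists_mem_cell (s := s) (hE ⟨zero_le, fun i hi => by
    rw [hs, Finsupp.indicator_of_notMem hi]; rfl⟩)
  refine ⟨q, hq, fun i hi => ?_⟩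
  by_contra hiq
  have h1 := hsq.2 i hiq
  rw [hs, Finsupp.indicator_of_mem hi] at h1
  have := Multiset.single_le_sum (s := C.map fun q => q.1 i) (fun _ _ => Nat.zero_le _) _
    (Multiset.mem_map_of_mem _ hq)
  omega

end cells

/-! ### Generating functions of cells -/

section generating

variable {σ τ : Type*} {w : σ → τ →₀ ℕ}

/-- The generating function, by weight, of an integer-valued function on exponents; for the
indicator function of a set, the coefficients count the exponents of a given weight in the set. -/
noncomputable def genFun (hw : ∀ d : τ →₀ ℕ, {s : σ →₀ ℕ | Finsupp.weight w s = d}.Finite)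
    (φ : (σ →₀ ℕ) → ℤ) : MvPowerSeries τ ℤ :=
  fun d => ∑ s ∈ (hw d).toFinset, φ s

variable (hw : ∀ d : τ →₀ ℕ, {s : σ →₀ ℕ | Finsupp.weight w s = d}.Finite)

lemma coeff_genFun (φ : (σ →₀ ℕ) → ℤ) (d : τ →₀ ℕ) :
    MvPowerSeries.coeff d (genFun hw φ) = ∑ s ∈ (hw d).toFinset, φ s := rfl

lemma genFun_add (φ ψ : (σ →₀ ℕ) → ℤ) : genFun hw (φ + ψ) = genFun hw φ + genFun hw ψ := by
  ext d
  simp only [map_add, coeff_genFun, Pi.add_apply, Finset.sum_add_distrib]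

lemma genFun_multiset_sum {ι : Type*} (C : Multiset ι) (φ : ι → (σ →₀ ℕ) → ℤ) :
    genFun hw (fun s => (C.map fun q => φ q s).sum) = (C.map fun q => genFun hw (φ q)).sum := by
  induction C using Multiset.induction with
  | empty => ext d; simp [coeff_genFun]
  | cons q C ih =>
    simp only [Multiset.map_cons, Multiset.sum_cons, ← ih, ← genFun_add]
    rfl

/-- Translation of the exponents by a basis vector multiplies the generating function by the
corresponding monomial. -/
lemma genFun_shift (i : σ) (φ ψ : (σ →₀ ℕ) → ℤ)
    (h : ∀ s, φ (s + Finsupp.single i 1) = ψ s) (h0 : ∀ s, s i = 0 → φ s = 0) :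
    genFun hw φ = MvPowerSeries.monomial (w i) 1 * genFun hw ψ := by
  classical
  have hwt : ∀ s, Finsupp.weight w (s + Finsupp.single i 1) = Finsupp.weight w s + w i := by
    intro s; simp [map_add, Finsupp.weight_single]
  have hsub : ∀ s : σ →₀ ℕ, s i ≠ 0 → s - Finsupp.single i 1 + Finsupp.single i 1 = s := fun s hs =>
    tsub_add_cancel_of_le (Finsupp.single_le_iff.2 (Nat.one_le_iff_ne_zero.2 hs))
  ext d
  rw [MvPowerSeries.coeff_monomial_mul, coeff_genFun]
  split_ifs with hd
  · rw [one_mul, coeff_genFun]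
    symm
    refine Finset.sum_of_injOn (fun s => s + Finsupp.single i 1)
      (fun _ _ _ _ h => add_right_cancel h) ?_ ?_ fun s _ => (h s).symm
    · intro s hs
      simp only [Set.Finite.coe_toFinset, Set.mem_ofPred_eq, hwt] at hs ⊢
      rw [hs, tsub_add_cancel_of_le hd]
    · intro s hs hs'
      refine h0 s (by_contra fun hsi => hs' ⟨s - Finsupp.single i 1, ?_, hsub s hsi⟩)
      simp only [Set.Finite.coe_toFinset, Set.Finite.mem_toFinset, Set.mem_ofPred_eq] at hs ⊢
      rw [← hsub s hsi, hwt] at hs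
      rw [← hs, add_tsub_cancel_right]
  · refine Finset.sum_eq_zero fun s hs => h0 s (by_contra fun hsi => hd ?_)
    simp only [Set.Finite.mem_toFinset, Set.mem_ofPred_eq] at hs
    rw [← hs, ← hsub s hsi, hwt]
    exact le_add_self

lemma genFun_cell_mul_prod (c : σ →₀ ℕ) (F : Finset σ) :
    genFun hw ((cell (c, F)).indicator 1) * ∏ i ∈ F, (1 - MvPowerSeries.monomial (w i) 1) =
      MvPowerSeries.monomial (Finsupp.weight w c) 1 := by
  classical
  induction F using Finset.induction_on with
  | empty =>
    have hc : cell (c, (∅ : Finset σ)) = {c} := by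
      ext s
      simp only [mem_cell, Finset.notMem_empty, not_false_eq_true, true_implies,
        Set.mem_singleton_iff]
      exact ⟨fun h => Finsupp.ext h.2, fun h => h ▸ ⟨le_rfl, fun _ => rfl⟩⟩
    ext d
    rw [Finset.prod_empty, mul_one, hc, coeff_genFun, MvPowerSeries.coeff_monomial]
    simp [Set.indicator_apply, eq_comm]
  | insert i F hi ih =>
    rw [Finset.prod_insert hi, ← mul_assoc, ← ih]
    congr 1
    have h1 : (cell (c, insert i F)).indicator (1 : (σ →₀ ℕ) → ℤ) = (cell (c, F)).indicator 1 +
        (cell (c + Finsupp.single i 1, insert i F)).indicator 1 := by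
      have hd := disjoint_cell_erase c (insert i F) i
      rw [cell_eq_union c (Finset.mem_insert_self i F)]
      rw [Finset.erase_insert hi] at hd ⊢
      rw [Set.indicator_union_of_disjoint hd]
      rfl
    have h2 : genFun hw ((cell (c + Finsupp.single i 1, insert i F)).indicator 1) =
        MvPowerSeries.monomial (w i) 1 * genFun hw ((cell (c, insert i F)).indicator 1) := by
      refine genFun_shift hw i _ _ (fun s => ?_) fun s hs => ?_
      · have : s + Finsupp.single i 1 ∈ cell (c + Finsupp.single i 1, insert i F) ↔
            s ∈ cell (c, insert i F) := by
          simp only [mem_cell, add_le_add_iff_right, Finsupp.add_apply, add_left_inj]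
        simp only [Set.indicator_apply, this, Pi.one_apply]
      · refine Set.indicator_of_notMem (fun h => ?_) _
        have := h.1 i
        simp [hs] at this
    have h3 := congrArg (genFun hw) h1
    rw [genFun_add, h2] at h3
    linear_combination h3

/-- The numerator of the generating function of a cell over the denominator `∏ (1 - X ^ w i)`. -/
noncomputable def cellPoly [Fintype σ] [DecidableEq σ] (w : σ → τ →₀ ℕ)
    (q : (σ →₀ ℕ) × Finset σ) : MvPolynomial τ ℤ :=
  MvPolynomial.monomial (Finsupp.weight w q.1) 1 *
    ∏ i ∈ q.2ᶜ, (1 - MvPolynomial.monomial (w i) 1)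

lemma coe_cellPoly [Fintype σ] [DecidableEq σ] (q : (σ →₀ ℕ) × Finset σ) :
    (cellPoly w q : MvPowerSeries τ ℤ) =
      genFun hw ((cell q).indicator 1) * ∏ i, (1 - MvPowerSeries.monomial (w i) 1) := by
  rw [← Finset.prod_mul_prod_compl q.2, ← mul_assoc, genFun_cell_mul_prod, cellPoly,
    MvPolynomial.coe_mul, MvPolynomial.coe_monomial]
  congr 1
  rw [← MvPolynomial.coeToMvPowerSeries.ringHom_apply, map_prod]
  refine Finset.prod_congr rfl fun i _ => ?_
  rw [map_sub, map_one, MvPolynomial.coeToMvPowerSeries.ringHom_apply, MvPolynomial.coe_monomial]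

lemma IsCellPartition.coe_sum_cellPoly [Fintype σ] [DecidableEq σ]
    {C : Multiset ((σ →₀ ℕ) × Finset σ)} {S : Set (σ →₀ ℕ)} (hC : IsCellPartition C S) :
    (((C.map (cellPoly w)).sum : MvPolynomial τ ℤ) : MvPowerSeries τ ℤ) =
      genFun hw (S.indicator 1) * ∏ i, (1 - MvPowerSeries.monomial (w i) 1) := by
  have h1 : S.indicator 1 = fun s =>
      (C.map fun q => (cell q).indicator (1 : (σ →₀ ℕ) → ℤ) s).sum := funext fun s => (hC s).symm
  rw [h1, genFun_multiset_sum, ← MvPolynomial.coeToMvPowerSeries.ringHom_apply, map_multiset_sum,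
    Multiset.map_map, ← Multiset.sum_map_mul_right]
  simp only [Function.comp_def, MvPolynomial.coeToMvPowerSeries.ringHom_apply, coe_cellPoly hw]

end generating

/-! ### Standard monomials -/

section standard

variable {σ τ : Type*} {k : Type*} [Field k]

/-- The exponents of the monomials that are not leading monomials of elements of `I`. -/
def standardMonomials (m : MonomialOrder σ) (I : Ideal (MvPolynomial σ k)) : Set (σ →₀ ℕ) :=
  {s | ∀ f ∈ I, f ≠ 0 → m.degree f ≠ s}

variable (m : MonomialOrder σ) (I : Ideal (MvPolynomial σ k))

lemma isLowerSet_standardMonomials : IsLowerSet (standardMonomials m I) := by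
  rintro s t hts hs f hf hf0 rfl
  have h1 : MvPolynomial.monomial (s - m.degree f) (1 : k) ≠ 0 := by simp
  refine hs _ (I.mul_mem_left (MvPolynomial.monomial (s - m.degree f) (1 : k)) hf)
    (mul_ne_zero h1 hf0) ?_
  classical
  rw [m.degree_mul h1 hf0, m.degree_monomial, if_neg one_ne_zero, tsub_add_cancel_of_le hts]

variable {m I}

lemma eq_zero_of_support_subset_standardMonomials {f : MvPolynomial σ k} (hf : f ∈ I)
    (hs : (f.support : Set (σ →₀ ℕ)) ⊆ standardMonomials m I) : f = 0 := by
  by_contra h0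
  exact hs (m.degree_mem_support h0) f hf h0 rfl

/-- Division with remainder: every polynomial is congruent to one all of whose monomials are
standard. -/
lemma exists_sub_mem_support_subset (m : MonomialOrder σ) (I : Ideal (MvPolynomial σ k))
    (f : MvPolynomial σ k) :
    ∃ r, f - r ∈ I ∧ (r.support : Set (σ →₀ ℕ)) ⊆ standardMonomials m I := by
  obtain ⟨g, r, hfr, -, hr⟩ := m.div_set (B := {b | b ∈ I ∧ b ≠ 0})
    (fun b hb => isUnit_iff_ne_zero.2 (m.leadingCoeff_ne_zero_iff.2 hb.2)) f
  refine ⟨r, ?_, fun c hc b hb hb0 hbc => hr c hc b ⟨hb, hb0⟩ hbc.le⟩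
  rw [hfr, add_sub_cancel_right, Finsupp.linearCombination_apply]
  exact Submodule.sum_mem _ fun b _ => I.mul_mem_left _ b.2.1

/-- The standard monomials of weight `d` give a basis of the part of weight `d` of the quotient
by a homogeneous ideal. -/
lemma finrank_map_mkₐ (m : MonomialOrder σ) {w : σ → τ →₀ ℕ}
    (hw : ∀ d : τ →₀ ℕ, {s : σ →₀ ℕ | Finsupp.weight w s = d}.Finite)
    (hI : ∀ f ∈ I, ∀ d, MvPolynomial.weightedHomogeneousComponent w d f ∈ I) (d : τ →₀ ℕ) :
    (Module.finrank k ((MvPolynomial.weightedHomogeneousSubmodule k w d).map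
      (Ideal.Quotient.mkₐ k I).toLinearMap) : ℤ) =
      MvPowerSeries.coeff d (genFun hw ((standardMonomials m I).indicator 1)) := by
  classical
  set S : Set (σ →₀ ℕ) := {s | s ∈ standardMonomials m I ∧ Finsupp.weight w s = d} with hS
  set V := MvPolynomial.restrictSupport k S
  have hVS : ∀ {f : MvPolynomial σ k}, f ∈ V ↔ (f.support : Set (σ →₀ ℕ)) ⊆ S := Iff.rfl
  have hmap : (MvPolynomial.weightedHomogeneousSubmodule k w d).map
      (Ideal.Quotient.mkₐ k I).toLinearMap =
      LinearMap.range ((Ideal.Quotient.mkₐ k I).toLinearMap.domRestrict V) := by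
    rw [LinearMap.range_domRestrict]
    apply le_antisymm
    · rintro _ ⟨f, hf, rfl⟩
      obtain ⟨r, hr, hrs⟩ := exists_sub_mem_support_subset m I f
      refine ⟨MvPolynomial.weightedHomogeneousComponent w d r, hVS.2 fun s hs => ?_, ?_⟩
      · rw [Finset.mem_coe, MvPolynomial.mem_support_iff,
          MvPolynomial.coeff_weightedHomogeneousComponent] at hs
        have hsd : Finsupp.weight w s = d := by by_contra h; simp [h] at hs
        rw [if_pos hsd] at hs
        exact ⟨hrs (Finset.mem_coe.2 (MvPolynomial.mem_support_iff.2 hs)), hsd⟩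
      · have h1 := hI _ hr d
        rw [map_sub, MvPolynomial.weightedHomogeneousComponent_of_mem hf, if_pos rfl] at h1
        exact (Ideal.Quotient.eq.2 h1).symm
    · refine Submodule.map_mono fun f hf s hs => ?_
      exact (hVS.1 hf (Finset.mem_coe.2 (MvPolynomial.mem_support_iff.2 hs))).2
  have hinj : Function.Injective ((Ideal.Quotient.mkₐ k I).toLinearMap.domRestrict V) := by
    rw [← LinearMap.ker_eq_bot, LinearMap.ker_eq_bot']
    rintro ⟨f, hf⟩ h0
    have h1 : f ∈ I := Ideal.Quotient.eq_zero_iff_mem.1 h0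
    exact Subtype.ext (eq_zero_of_support_subset_standardMonomials (m := m) h1
      fun s hs => (hVS.1 hf hs).1)
  rw [hmap, LinearMap.finrank_range_of_inj hinj,
    Module.finrank_eq_nat_card_basis (MvPolynomial.basisRestrictSupport k S), coeff_genFun]
  simp only [Set.indicator_apply, Pi.one_apply, Finset.sum_boole]
  congr 1
  rw [Nat.card_coe_set_eq, ← Set.ncard_coe_finset]
  congr 1
  ext s
  simp [hS, and_comm]

end standard

/-- A monomial order (lexicographic, with the variables outside of `E` first) for which the
polynomials in the variables `E` are those with leading monomial in the variables `E`. -/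
lemma exists_elimination_monomialOrder {σ : Type} [Finite σ] (E : Finset σ) :
    ∃ m : MonomialOrder.{0, 0} σ, ∀ a b : σ →₀ ℕ, m.toSyn a ≤ m.toSyn b →
      b.support ⊆ E → a.support ⊆ E := by
  classical
  have := Fintype.ofFinite σ
  let e := Fintype.equivFin σ
  let key : σ → Bool ×ₗ Fin (Fintype.card σ) := fun i => toLex (decide (i ∈ E), e i)
  have hkey : Function.Injective key := fun i j h => by
    have := congrArg (fun x => (ofLex x).2) h
    exact e.injective this
  let _ : LinearOrder σ := LinearOrder.lift' key hkey
  have hlt : ∀ i j, i ∉ E → j ∈ E → i < j := by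
    intro i j hi hj
    change key i < key j
    rw [Prod.Lex.lt_iff]
    left
    simp [key, hi, hj]
  refine ⟨MonomialOrder.lex, fun a b hab hb i hi => ?_⟩
  by_contra hiE
  have hbi : b i = 0 := by
    by_contra h; exact hiE (hb (Finsupp.mem_support_iff.2 h))
  rcases (MonomialOrder.lex_le_iff.1 hab).eq_or_lt with h | h
  · rw [toLex.injective h] at hi
    exact Finsupp.mem_support_iff.1 hi hbi
  · obtain ⟨j, hj, hj'⟩ := Finsupp.Lex.lt_iff.1 h
    have hjE : j ∈ E := hb (Finsupp.mem_support_iff.2 (by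
      intro h0; change a j < b j at hj'; omega))
    have := hj i (hlt i j hiE hjE)
    exact Finsupp.mem_support_iff.1 hi (this.trans hbi)

/-! ### Lowest-degree parts -/

section lowest

variable {τ : Type*}

/-- The homomorphism that marks the degree of a polynomial by an additional variable: the
coefficients of the image are the homogeneous components. -/
noncomputable def degreeHom (τ : Type*) :
    MvPolynomial τ ℤ →ₐ[ℤ] Polynomial (MvPolynomial τ ℤ) :=
  MvPolynomial.aeval fun i => Polynomial.C (MvPolynomial.X i) * Polynomial.X

lemma coeff_degreeHom (P : MvPolynomial τ ℤ) (k : ℕ) :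
    (degreeHom τ P).coeff k = MvPolynomial.homogeneousComponent k P := by
  induction P using MvPolynomial.induction_on' with
  | add P Q hP hQ => rw [map_add, map_add, Polynomial.coeff_add, hP, hQ]
  | monomial s c =>
    have h1 : degreeHom τ (MvPolynomial.monomial s c) =
        Polynomial.C (MvPolynomial.monomial s c) * Polynomial.X ^ s.degree := by
      rw [degreeHom, MvPolynomial.aeval_monomial, MvPolynomial.monomial_eq, map_mul,
        Finsupp.prod, Finsupp.prod, map_prod, Finsupp.degree_apply, ← Finset.prod_pow_eq_pow_sum]
      simp only [mul_pow, Finset.prod_mul_distrib, map_pow]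
      rw [← mul_assoc]
      congr 2
    rw [h1, Polynomial.coeff_C_mul_X_pow, MvPolynomial.homogeneousComponent_of_mem
      (MvPolynomial.isHomogeneous_monomial c rfl)]

/-- `P` has no terms of degree less than `k`, and `Q` is its part of degree `k`. -/
def HasLowTerm (k : ℕ) (Q P : MvPolynomial τ ℤ) : Prop :=
  ∃ R, degreeHom τ P = Polynomial.C Q * Polynomial.X ^ k + R * Polynomial.X ^ (k + 1)

lemma HasLowTerm.zero (k : ℕ) : HasLowTerm k (0 : MvPolynomial τ ℤ) 0 := ⟨0, by simp⟩

lemma HasLowTerm.add {k : ℕ} {P Q P' Q' : MvPolynomial τ ℤ} (h : HasLowTerm k Q P)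
    (h' : HasLowTerm k Q' P') : HasLowTerm k (Q + Q') (P + P') := by
  obtain ⟨R, hR⟩ := h
  obtain ⟨R', hR'⟩ := h'
  exact ⟨R + R', by rw [map_add, hR, hR', map_add]; ring⟩

lemma HasLowTerm.mul {k k' : ℕ} {P Q P' Q' : MvPolynomial τ ℤ} (h : HasLowTerm k Q P)
    (h' : HasLowTerm k' Q' P') : HasLowTerm (k + k') (Q * Q') (P * P') := by
  obtain ⟨R, hR⟩ := h
  obtain ⟨R', hR'⟩ := h'
  exact ⟨Polynomial.C Q * R' + R * Polynomial.C Q' + R * R' * Polynomial.X, by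
    rw [map_mul, hR, hR', map_mul]; ring⟩

lemma HasLowTerm.of_lt {k k' : ℕ} {P Q : MvPolynomial τ ℤ} (h : HasLowTerm k Q P)
    (hk : k' < k) : HasLowTerm k' 0 P := by
  obtain ⟨R, hR⟩ := h
  obtain ⟨j, rfl⟩ := Nat.exists_eq_add_of_lt hk
  exact ⟨Polynomial.C Q * Polynomial.X ^ j + R * Polynomial.X ^ (j + 1), by
    rw [hR, map_zero]; ring⟩

lemma HasLowTerm.prod {ι : Type*} (s : Finset ι) {P Q : ι → MvPolynomial τ ℤ}
    (h : ∀ i ∈ s, HasLowTerm 1 (Q i) (P i)) :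
    HasLowTerm s.card (∏ i ∈ s, Q i) (∏ i ∈ s, P i) := by
  classical
  induction s using Finset.induction_on with
  | empty => exact ⟨0, by simp⟩
  | insert i s hi ih =>
    rw [Finset.prod_insert hi, Finset.prod_insert hi, Finset.card_insert_of_notMem hi, add_comm]
    exact (h i (Finset.mem_insert_self i s)).mul
      (ih fun j hj => h j (Finset.mem_insert_of_mem hj))

lemma HasLowTerm.multiset_sum {ι : Type*} {k : ℕ} (s : Multiset ι) {P Q : ι → MvPolynomial τ ℤ}
    (h : ∀ i ∈ s, HasLowTerm k (Q i) (P i)) :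
    HasLowTerm k (s.map Q).sum (s.map P).sum := by
  induction s using Multiset.induction with
  | empty => exact HasLowTerm.zero k
  | cons i s ih =>
    rw [Multiset.map_cons, Multiset.map_cons, Multiset.sum_cons, Multiset.sum_cons]
    exact (h i (Multiset.mem_cons_self i s)).add
      (ih fun j hj => h j (Multiset.mem_cons_of_mem hj))

lemma HasLowTerm.homogeneousComponent_eq {k : ℕ} {P Q : MvPolynomial τ ℤ}
    (h : HasLowTerm k Q P) : MvPolynomial.homogeneousComponent k P = Q := by
  obtain ⟨R, hR⟩ := h
  rw [← coeff_degreeHom, hR]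
  simp [Polynomial.coeff_mul_X_pow']

lemma HasLowTerm.lowestPart_eq {k : ℕ} {P Q : MvPolynomial τ ℤ} (h : HasLowTerm k Q P)
    (hQ : Q ≠ 0) : lowestPart P = Q := by
  have hk : sInf {d : ℕ | MvPolynomial.homogeneousComponent d P ≠ 0} = k := by
    have hmem : k ∈ {d : ℕ | MvPolynomial.homogeneousComponent d P ≠ 0} := by
      rw [Set.mem_ofPred_eq, h.homogeneousComponent_eq]; exact hQ
    refine le_antisymm (Nat.sInf_le hmem) (le_csInf ⟨k, hmem⟩ fun d hd => ?_)
    by_contra hlt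
    exact hd (h.of_lt (not_le.1 hlt)).homogeneousComponent_eq
  rw [lowestPart, hk, h.homogeneousComponent_eq]

end lowest

/-! ### The class of a cell -/

section entry

variable {n : ℕ}

lemma finite_weight_entryWeight (d : (Fin n ⊕ Fin n) →₀ ℕ) :
    {s : Fin n × Fin n →₀ ℕ | Finsupp.weight (entryWeight n) s = d}.Finite := by
  refine (Set.finite_Iic (Finsupp.equivFunOnFinite.symm fun p : Fin n × Fin n =>
    d (Sum.inl p.1))).subset ?_
  rintro s rfl p
  rw [Finsupp.equivFunOnFinite_symm_apply_apply, Finsupp.weight_apply,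
    Finsupp.sum_fintype _ _ (by simp), Finsupp.finsetSum_apply]
  refine le_trans ?_ (Finset.single_le_sum (fun _ _ => Nat.zero_le _) (Finset.mem_univ p))
  simp [entryWeight]

/-- The substitution `T = 1 - x`, `S = 1 + y` turns monomials into polynomials with constant
term `1`. -/
lemma hasLowTerm_toCohomology_monomial (s : (Fin n ⊕ Fin n) →₀ ℕ) :
    HasLowTerm 0 1 (toCohomology n (MvPolynomial.monomial s 1)) := by
  set χ : MvPolynomial (Fin n ⊕ Fin n) ℤ →+* MvPolynomial (Fin n ⊕ Fin n) ℤ :=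
    (Polynomial.evalRingHom 0).comp
      ((degreeHom (Fin n ⊕ Fin n)).toRingHom.comp (toCohomology n).toRingHom) with hχ
  have h1 : χ = MvPolynomial.eval₂Hom MvPolynomial.C fun _ => 1 := by
    apply MvPolynomial.ringHom_ext
    · intro c; simp [hχ, degreeHom, toCohomology]
    · rintro (a | b) <;> simp [hχ, degreeHom, toCohomology]
  have h2 : (degreeHom _ (toCohomology n (MvPolynomial.monomial s 1))).coeff 0 = 1 := by
    have := congrArg (fun g => g (MvPolynomial.monomial s 1)) h1
    rw [Polynomial.coeff_zero_eq_eval_zero]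
    refine this.trans ?_
    rw [MvPolynomial.coe_eval₂Hom, MvPolynomial.eval₂_monomial]
    simp
  refine ⟨Polynomial.divX (degreeHom _ (toCohomology n (MvPolynomial.monomial s 1))), ?_⟩
  rw [pow_zero, mul_one, zero_add, pow_one, add_comm, ← h2, Polynomial.divX_mul_X_add]

/-- The class `x_a - y_b` of the hyperplane `m_{ab} = 0`. -/
noncomputable def hyperplaneClass (p : Fin n × Fin n) : MvPolynomial (Fin n ⊕ Fin n) ℤ :=
  MvPolynomial.X (Sum.inl p.1) - MvPolynomial.X (Sum.inr p.2)

lemma hasLowTerm_toCohomology_one_sub (p : Fin n × Fin n) :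
    HasLowTerm 1 (hyperplaneClass p)
      (toCohomology n (1 - MvPolynomial.monomial (entryWeight n p) 1)) := by
  have h : MvPolynomial.monomial (entryWeight n p) (1 : ℤ) =
      MvPolynomial.X (Sum.inl p.1) * MvPolynomial.X (Sum.inr p.2) := by
    rw [entryWeight, MvPolynomial.X, MvPolynomial.X, MvPolynomial.monomial_mul, one_mul]
  refine ⟨Polynomial.C (MvPolynomial.X (Sum.inl p.1) * MvPolynomial.X (Sum.inr p.2)), ?_⟩
  rw [h]
  simp [toCohomology, degreeHom, hyperplaneClass]
  ring

lemma hasLowTerm_cellPoly (q : (Fin n × Fin n →₀ ℕ) × Finset (Fin n × Fin n)) :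
    HasLowTerm q.2ᶜ.card (∏ p ∈ q.2ᶜ, hyperplaneClass p)
      (toCohomology n (cellPoly (entryWeight n) q)) := by
  rw [cellPoly, map_mul, map_prod]
  have := (hasLowTerm_toCohomology_monomial (Finsupp.weight (entryWeight n) q.1)).mul
    (HasLowTerm.prod q.2ᶜ fun p _ => hasLowTerm_toCohomology_one_sub p)
  rwa [zero_add, one_mul] at this

/-- If the cells of `C` have at most `e` directions, with equality for at least one, then the
sum of their numerators has its lowest term in degree the codimension of these top cells: their
contributions are products of classes `x_a - y_b`, which cannot cancel since all of them take
the value `1` at `x = 1`, `y = 0`. -/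
lemma exists_hasLowTerm_sum_cellPoly
    (C : Multiset ((Fin n × Fin n →₀ ℕ) × Finset (Fin n × Fin n))) {e : ℕ}
    (hle : ∀ q ∈ C, q.2.card ≤ e) (hex : ∃ q ∈ C, q.2.card = e) :
    ∃ Q, Q ≠ 0 ∧ HasLowTerm (Fintype.card (Fin n × Fin n) - e) Q
      (toCohomology n (C.map (cellPoly (entryWeight n))).sum) := by
  classical
  set Q : (Fin n × Fin n →₀ ℕ) × Finset (Fin n × Fin n) → MvPolynomial (Fin n ⊕ Fin n) ℤ :=
    fun q => if q.2.card = e then ∏ p ∈ q.2ᶜ, hyperplaneClass p else 0 with hQ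
  refine ⟨(C.map Q).sum, fun h0 => ?_, ?_⟩
  · have h1 : ∀ q, MvPolynomial.eval (Sum.elim 1 0) (Q q) = if q.2.card = e then 1 else 0 := by
      intro q
      simp only [hQ]
      split_ifs <;> simp [hyperplaneClass]
    have h2 := congrArg (MvPolynomial.eval (Sum.elim (1 : Fin n → ℤ) (0 : Fin n → ℤ))) h0
    rw [map_multiset_sum, Multiset.map_map, map_zero] at h2
    simp only [Function.comp_def, h1] at h2
    obtain ⟨q, hq, hqe⟩ := hex
    have h3 := Multiset.single_le_sum
      (s := C.map fun q => if q.2.card = e then (1 : ℤ) else 0) (by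
        intro x hx
        obtain ⟨q, -, rfl⟩ := Multiset.mem_map.1 hx
        split_ifs <;> simp) _ (Multiset.mem_map_of_mem _ hq)
    rw [h2, if_pos hqe] at h3
    exact absurd h3 (by simp)
  · rw [map_multiset_sum, Multiset.map_map]
    refine HasLowTerm.multiset_sum C fun q hq => ?_
    have hcell := hasLowTerm_cellPoly q
    have hc := Finset.card_compl q.2
    have hq1 := hle q hq
    have he : e ≤ Fintype.card (Fin n × Fin n) := by
      obtain ⟨q', -, rfl⟩ := hex
      exact Finset.card_le_univ q'.2
    by_cases h : q.2.card = e
    · simp only [hQ, if_pos h]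
      rwa [hc, h] at hcell
    · simp only [hQ, if_neg h]
      exact hcell.of_lt (by omega)

end entry

variable {n : ℕ}

/-! ### The class of the variety -/

lemma cell_zero_subset {σ : Type*} {S : Set (σ →₀ ℕ)} (hS : IsLowerSet S)
    {q : (σ →₀ ℕ) × Finset σ} (hq : cell q ⊆ S) : cell (0, q.2) ⊆ S := by
  intro s hs
  refine hS (le_add_self : s ≤ q.1 + s) (hq ⟨le_self_add, fun i hi => ?_⟩)
  rw [Finsupp.add_apply, hs.2 i hi]
  rfl

/-- Variables all of whose monomials are standard are algebraically independent on the variety,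
hence at most as many as the dimension of the source of the dominant chart. -/
lemma card_le_of_cell_subset {π : Fin n ≃. Fin n} {m : MonomialOrder (Fin n × Fin n)}
    {F : Finset (Fin n × Fin n)}
    (hF : cell (0, F) ⊆ standardMonomials m (idealOf (matrixSchubertVariety π))) :
    F.card ≤ Fintype.card (OffDiagram π) := by
  have hind : AlgebraicIndependent ℂ fun p : F => chartHom π (MvPolynomial.X p.1) := by
    rw [AlgebraicIndependent, injective_iff_map_eq_zero]
    intro g hg
    have h1 : chartHom π (MvPolynomial.rename Subtype.val g) = 0 := by
      rw [← hg, ← AlgHom.comp_apply]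
      congr 1
      apply MvPolynomial.algHom_ext
      intro p; simp
    have h2 := eq_zero_of_support_subset_standardMonomials (m := m)
      (mem_idealOf_of_chartHom_eq_zero h1) fun s hs => hF ⟨zero_le, fun p hp => by
        obtain ⟨u, rfl, -⟩ := MvPolynomial.coeff_rename_ne_zero _ _ _
          (MvPolynomial.mem_support_iff.1 (Finset.mem_coe.1 hs))
        rw [Finsupp.mapDomain_of_notMem_range]
        · rfl
        · rintro ⟨x, rfl⟩; exact hp x.2⟩
    exact MvPolynomial.rename_injective _ Subtype.val_injective (by rw [h2, map_zero])
  have := hind.cardinalMk_le_trdeg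
  rw [MvPolynomial.trdeg_of_isDomain] at this
  simpa using this

/-- For an elimination order, the monomials in the variables outside of the Rothe diagram are
standard, since these variables are algebraically independent on the variety. -/
lemma cell_subset_standardMonomials {π : Fin n ≃. Fin n} {m : MonomialOrder (Fin n × Fin n)}
    (hm : ∀ a b : Fin n × Fin n →₀ ℕ, m.toSyn a ≤ m.toSyn b →
      b.support ⊆ (rotheDiagram π)ᶜ → a.support ⊆ (rotheDiagram π)ᶜ) :
    cell (0, (rotheDiagram π)ᶜ) ⊆
      standardMonomials m (idealOf (matrixSchubertVariety π)) := by
  rintro s ⟨-, hs⟩ f hf hf0 rfl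
  have hsupp : (m.degree f).support ⊆ (rotheDiagram π)ᶜ := by
    intro p hp
    by_contra h
    exact Finsupp.mem_support_iff.1 hp (hs p h)
  have hvars : (f.vars : Set (Fin n × Fin n)) ⊆
      Set.range (Subtype.val : OffDiagram π → Fin n × Fin n) := by
    intro p hp
    obtain ⟨t, ht, hpt⟩ := (MvPolynomial.mem_vars_iff_mem_support p).1 (Finset.mem_coe.1 hp)
    have := hm t _ (m.le_degree ht) hsupp hpt
    exact ⟨⟨p, Finset.mem_compl.1 this⟩, rfl⟩
  obtain ⟨g, rfl⟩ := MvPolynomial.exists_rename_eq_of_vars_subset_range f Subtype.val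
    Subtype.val_injective hvars
  rw [eq_zero_of_rename_mem_idealOf hf, map_zero] at hf0
  exact hf0 rfl

/-- The numerator of the Hilbert series is a polynomial, with lowest term in degree the number of
boxes of the Rothe diagram. -/
lemma exists_kSeries_eq (π : Fin n ≃. Fin n) :
    ∃ K : MvPolynomial (Fin n ⊕ Fin n) ℤ,
      (K : MvPowerSeries (Fin n ⊕ Fin n) ℤ) = kSeries (matrixSchubertVariety π) ∧
      ∃ Q, Q ≠ 0 ∧ HasLowTerm (rotheDiagram π).card Q (toCohomology n K) := by
  classical
  obtain ⟨m, hm⟩ := exists_elimination_monomialOrder (rotheDiagram π)ᶜ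
  set I := idealOf (matrixSchubertVariety π)
  have hlow := isLowerSet_standardMonomials m I
  obtain ⟨C, hC⟩ := exists_isCellPartition hlow
  have hcard : Fintype.card (OffDiagram π) = (rotheDiagram π)ᶜ.card := by
    rw [Fintype.card_subtype]; congr 1; ext; simp
  have hle : ∀ q ∈ C, q.2.card ≤ (rotheDiagram π)ᶜ.card := fun q hq =>
    hcard ▸ card_le_of_cell_subset (cell_zero_subset hlow (hC.cell_subset hq))
  have hex : ∃ q ∈ C, q.2.card = (rotheDiagram π)ᶜ.card := by
    obtain ⟨q, hq, hsub⟩ := hC.exists_subset (cell_subset_standardMonomials hm)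
    exact ⟨q, hq, le_antisymm (hle q hq) (Finset.card_le_card hsub)⟩
  refine ⟨(C.map (cellPoly (entryWeight n))).sum, ?_, ?_⟩
  · rw [hC.coe_sum_cellPoly finite_weight_entryWeight, kSeries]
    congr 1
    · ext d
      rw [← finrank_map_mkₐ m finite_weight_entryWeight
        (fun f hf d => weightedHomogeneousComponent_mem_idealOf hf d) d]
      rfl
    · refine Finset.prod_congr rfl fun p _ => ?_
      rw [MvPowerSeries.X, MvPowerSeries.X, MvPowerSeries.monomial_mul_monomial, one_mul]
      rfl
  · obtain ⟨Q, hQ0, hQ⟩ := exists_hasLowTerm_sum_cellPoly C hle hex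
    refine ⟨Q, hQ0, ?_⟩
    have h := Finset.card_compl (rotheDiagram π)
    have h' := Finset.card_le_univ (rotheDiagram π)
    rwa [h, Nat.sub_sub_self h'] at hQ

lemma matrixSchubertClass_spec (π : Fin n ≃. Fin n) :
    matrixSchubertClass π ≠ 0 ∧
      (matrixSchubertClass π).IsHomogeneous (rotheDiagram π).card := by
  obtain ⟨K, hK, Q, hQ0, hQ⟩ := exists_kSeries_eq π
  have hex : ∃ K : MvPolynomial (Fin n ⊕ Fin n) ℤ,
      (K : MvPowerSeries (Fin n ⊕ Fin n) ℤ) = kSeries (matrixSchubertVariety π) := ⟨K, hK⟩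
  have h1 : hex.choose = K :=
    MvPolynomial.coe_injective _ _ (hex.choose_spec.trans hK.symm)
  have h2 : matrixSchubertClass π = Q := by
    rw [matrixSchubertClass, equivariantClass, dif_pos hex, h1, hQ.lowestPart_eq hQ0]
  rw [h2]
  refine ⟨hQ0, ?_⟩
  rw [← hQ.homogeneousComponent_eq]
  exact MvPolynomial.homogeneousComponent_isHomogeneous _ _

/-! ### Lengths of permutations with a given Northwest corner -/

/-- The box `(a, b)` of the diagram of the corner gives the inversion `a < ρ⁻¹ b` of `ρ`. -/
lemma card_rotheDiagram_le_length {m : ℕ} (h : n ≤ m) {ρ : Equiv.Perm (Fin m)}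
    {π : Fin n ≃. Fin n} (hρ : HasNWCorner h ρ π) : (rotheDiagram π).card ≤ length ρ := by
  refine Finset.card_le_card_of_injOn
    (fun p => (Fin.castLE h p.1, ρ.symm (Fin.castLE h p.2))) ?_ ?_
  · intro p hp
    rw [Finset.mem_coe, mem_rotheDiagram] at hp
    simp only [Finset.coe_filter, Finset.mem_univ, true_and, Set.mem_ofPred_eq,
      Equiv.apply_symm_apply]
    constructor
    · by_contra hlt
      rw [not_lt] at hlt
      have hlt' : (ρ.symm (Fin.castLE h p.2)).val ≤ p.1.val := hlt
      have hi : ρ (Fin.castLE h ⟨(ρ.symm (Fin.castLE h p.2)).val, hlt'.trans_lt p.1.2⟩) =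
          Fin.castLE h p.2 := by
        conv_rhs => rw [← ρ.apply_symm_apply (Fin.castLE h p.2)]
        rfl
      exact hp.2 _ hlt' ((hρ _ _).1 hi)
    · by_contra hlt
      rw [not_lt] at hlt
      have hlt' : (ρ (Fin.castLE h p.1)).val ≤ p.2.val := hlt
      have hi : ρ (Fin.castLE h p.1) =
          Fin.castLE h ⟨(ρ (Fin.castLE h p.1)).val, hlt'.trans_lt p.2.2⟩ := rfl
      exact hp.1 _ hlt' ((hρ _ _).1 hi)
  · intro p _ q _ hpq
    simp only [Prod.mk.injEq, EmbeddingLike.apply_eq_iff_eq] at hpq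
    exact Prod.ext (Fin.castLE_injective h hpq.1) (Fin.castLE_injective h hpq.2)

/-- A permutation whose inversions all come from boxes of the Northwest corner has length at most
the size of the diagram of the corner. -/
lemma length_le_card_rotheDiagram {m : ℕ} (h : n ≤ m) {ρ : Equiv.Perm (Fin m)}
    {π : Fin n ≃. Fin n} (hρ : HasNWCorner h ρ π)
    (hinv : ∀ i j, i < j → ρ j < ρ i → i.val < n ∧ (ρ j).val < n) :
    length ρ ≤ (rotheDiagram π).card := by
  rw [length, ← Finset.card_image_of_injective (rotheDiagram π)
    (f := fun p : Fin n × Fin n => (Fin.castLE h p.1, ρ.symm (Fin.castLE h p.2)))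
    (fun p q hpq => by
      simp only [Prod.mk.injEq, EmbeddingLike.apply_eq_iff_eq] at hpq
      exact Prod.ext (Fin.castLE_injective h hpq.1) (Fin.castLE_injective h hpq.2))]
  refine Finset.card_le_card fun p hp => ?_
  simp only [Finset.mem_filter, Finset.mem_univ, true_and] at hp
  obtain ⟨h1, h2⟩ := hinv _ _ hp.1 hp.2
  have e1 : Fin.castLE h ⟨p.1.val, h1⟩ = p.1 := rfl
  have e2 : Fin.castLE h ⟨(ρ p.2).val, h2⟩ = ρ p.2 := rfl
  refine Finset.mem_image.2 ⟨(⟨p.1.val, h1⟩, ⟨(ρ p.2).val, h2⟩), ?_, by simp [e1, e2]⟩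
  rw [mem_rotheDiagram]
  constructor
  · intro j hj hπ
    have := (hρ _ _).2 hπ
    rw [e1] at this
    rw [this] at hp
    exact absurd hp.2 (not_lt.2 (show (Fin.castLE h j).val ≤ (ρ p.2).val from hj))
  · intro i hi hπ
    have := (hρ _ _).2 hπ
    rw [e2] at this
    have hi' : (Fin.castLE h i).val ≤ p.1.val := hi
    rw [ρ.injective this] at hi'
    exact absurd hp.1 (not_lt.2 hi')

/-- The standard extension of `π` to a permutation: the rows without a `1` are mapped in increasing
order to the new columns, and the new rows in increasing order to the columns without a `1`. -/
lemma exists_extension (π : Fin n ≃. Fin n) :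
    ∃ (m : ℕ) (h : n ≤ m) (ρ : Equiv.Perm (Fin m)), HasNWCorner h ρ π ∧
      ∀ i j, i < j → ρ j < ρ i → i.val < n ∧ (ρ j).val < n := by
  classical
  set A : Finset (Fin n) := Finset.univ.filter fun i => π i = none with hA
  set B : Finset (Fin n) := Finset.univ.filter fun j => π.symm j = none with hB
  have hAmem : ∀ i, i ∉ A → ∃ j, j ∈ π i := by
    intro i hi
    exact Option.ne_none_iff_exists'.1 fun h => hi (by simp [hA, h])
  have hBmem : ∀ i j, j ∈ π i → j ∉ B := by
    intro i j hij hj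
    have := (Finset.mem_filter.1 hj).2
    rw [(π.mem_iff_mem).2 hij] at this
    cases this
  choose! p hp using hAmem
  have hAB : B.card = A.card := by
    have hc : Aᶜ.card = Bᶜ.card := by
      refine Finset.card_bij (fun i _ => p i) (fun i hi => ?_) (fun i hi j hj hij => ?_) ?_
      · exact Finset.mem_compl.2 (hBmem i _ (hp i (Finset.mem_compl.1 hi)))
      · have := hp j (Finset.mem_compl.1 hj)
        rw [← hij] at this
        exact π.inj (hp i (Finset.mem_compl.1 hi)) this
      · intro j hj
        obtain ⟨i, hi⟩ : ∃ i, i ∈ π.symm j := by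
          exact Option.ne_none_iff_exists'.1 fun h => Finset.mem_compl.1 hj (by simp [hB, h])
        rw [π.mem_iff_mem] at hi
        have hiA : i ∉ A := fun h => by
          rw [Option.mem_def, (Finset.mem_filter.1 h).2] at hi
          cases hi
        exact ⟨i, Finset.mem_compl.2 hiA, Option.mem_unique (hp i hiA) hi⟩
    have h1 := Finset.card_compl A
    have h2 := Finset.card_compl B
    have h3 := Finset.card_le_univ A
    have h4 := Finset.card_le_univ B
    omega
  set k := A.card
  let a : A ≃o Fin k := (A.orderIsoOfFin rfl).symm
  let b : Fin k ≃o B := B.orderIsoOfFin hAB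
  let r : Fin n → Fin (n + k) := fun i =>
    if hi : i ∈ A then Fin.natAdd n (a ⟨i, hi⟩) else Fin.castAdd k (p i)
  let f : Fin (n + k) → Fin (n + k) := Fin.addCases r fun x => Fin.castAdd k (b x).1
  have hf1 : ∀ i, i ∉ A → f (Fin.castAdd k i) = Fin.castAdd k (p i) := fun i hi => by
    simp only [f, Fin.addCases_left, r, dif_neg hi]
  have hf2 : ∀ i (hi : i ∈ A), f (Fin.castAdd k i) = Fin.natAdd n (a ⟨i, hi⟩) := fun i hi => by
    simp only [f, Fin.addCases_left, r, dif_pos hi]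
  have hf3 : ∀ x, f (Fin.natAdd n x) = Fin.castAdd k (b x).1 := fun x => by
    simp only [f, Fin.addCases_right]
  have hne : ∀ (i : Fin n) (x : Fin k), Fin.castAdd k i ≠ Fin.natAdd n x := by
    intro i x h
    have := congrArg Fin.val h
    simp only [Fin.val_castAdd, Fin.val_natAdd] at this
    omega
  have hfinj : Function.Injective f := by
    intro i j
    refine Fin.addCases (fun i => ?_) (fun x => ?_) i <;>
      refine Fin.addCases (fun j => ?_) (fun y => ?_) j
    · intro h
      by_cases hi : i ∈ A <;> by_cases hj : j ∈ A
      · rw [hf2 i hi, hf2 j hj, Fin.natAdd_inj, a.injective.eq_iff] at h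
        exact congrArg (Fin.castAdd k) (congrArg Subtype.val h)
      · rw [hf2 i hi, hf1 j hj] at h; exact absurd h.symm (hne _ _)
      · rw [hf1 i hi, hf2 j hj] at h; exact absurd h (hne _ _)
      · rw [hf1 i hi, hf1 j hj, Fin.castAdd_inj] at h
        have := hp j hj
        rw [← h] at this
        rw [π.inj (hp i hi) this]
    · intro h
      by_cases hi : i ∈ A
      · rw [hf2 i hi, hf3] at h; exact absurd h.symm (hne _ _)
      · rw [hf1 i hi, hf3, Fin.castAdd_inj] at h
        exact absurd (b y).2 (h ▸ hBmem i _ (hp i hi))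
    · intro h
      by_cases hj : j ∈ A
      · rw [hf2 j hj, hf3] at h; exact absurd h (hne _ _)
      · rw [hf1 j hj, hf3, Fin.castAdd_inj] at h
        exact absurd (b x).2 (h ▸ hBmem j _ (hp j hj))
    · intro h
      rw [hf3, hf3, Fin.castAdd_inj] at h
      rw [b.injective (Subtype.ext h)]
  refine ⟨n + k, Nat.le_add_right n k,
    Equiv.ofBijective f (Finite.injective_iff_bijective.1 hfinj), fun i j => ?_, ?_⟩
  · change f (Fin.castAdd k i) = Fin.castAdd k j ↔ j ∈ π i
    by_cases hi : i ∈ A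
    · rw [hf2 i hi, Option.mem_def, (Finset.mem_filter.1 hi).2]
      exact ⟨fun h => absurd h.symm (hne _ _), fun h => by cases h⟩
    · rw [hf1 i hi, Fin.castAdd_inj]
      exact ⟨fun h => h ▸ hp i hi, fun h => Option.mem_unique (hp i hi) h⟩
  · simp only [Equiv.ofBijective_apply]
    intro i j
    refine Fin.addCases (fun i => ?_) (fun x => ?_) i <;>
      refine Fin.addCases (fun j => ?_) (fun y => ?_) j <;> intro hij hlt
    · refine ⟨i.2, ?_⟩
      by_cases hj : j ∈ A
      · exfalso
        by_cases hi : i ∈ A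
        · rw [hf2 i hi, hf2 j hj, Fin.natAdd_lt_natAdd_iff, a.lt_iff_lt] at hlt
          exact lt_asymm hlt hij
        · rw [hf1 i hi, hf2 j hj, Fin.lt_def, Fin.val_castAdd, Fin.val_natAdd] at hlt
          omega
      · rw [hf1 j hj]; exact (p j).2
    · rw [hf3]; exact ⟨i.2, (b y).1.2⟩
    · rw [Fin.lt_def, Fin.val_castAdd, Fin.val_natAdd] at hij
      omega
    · rw [Fin.natAdd_lt_natAdd_iff] at hij
      rw [hf3, hf3] at hlt
      exact absurd hlt (lt_asymm (b.lt_iff_lt.2 hij))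

lemma isLeast_card_rotheDiagram (π : Fin n ≃. Fin n) :
    IsLeast {l : ℕ | ∃ (m : ℕ) (h : n ≤ m) (ρ : Equiv.Perm (Fin m)),
      HasNWCorner h ρ π ∧ length ρ = l} (rotheDiagram π).card := by
  constructor
  · obtain ⟨m, h, ρ, hρ, hinv⟩ := exists_extension π
    exact ⟨m, h, ρ, hρ, le_antisymm (length_le_card_rotheDiagram h hρ hinv)
      (card_rotheDiagram_le_length h hρ)⟩
  · rintro _ ⟨m, h, ρ, hρ, rfl⟩
    exact card_rotheDiagram_le_length h hρ

end MatrixSchubert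

theorem mainTheorem7 (n : ℕ) (π : Fin n ≃. Fin n) :
    -- the tangent space is invariant under `T × T`
    (∀ t s : Fin n → ℂˣ,
      ∀ Z ∈ MatrixSchubert.tangentSpace (MatrixSchubert.matrixSchubertVariety π)
          (MatrixSchubert.permMatrix π),
        Matrix.diagonal (fun i => (t i : ℂ)) * Z * Matrix.diagonal (fun j => ((s j)⁻¹ : ℂ)) ∈
          MatrixSchubert.tangentSpace (MatrixSchubert.matrixSchubertVariety π)
            (MatrixSchubert.permMatrix π)) ∧
    -- it is spanned by the matrix entries outside of the Rothe diagram
    MatrixSchubert.tangentSpace (MatrixSchubert.matrixSchubertVariety π)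
        (MatrixSchubert.permMatrix π) =
      Submodule.span ℂ {Z : Matrix (Fin n) (Fin n) ℂ |
        ∃ a b : Fin n, (a, b) ∉ MatrixSchubert.rotheDiagram π ∧ Z = Matrix.single a b 1} ∧
    -- the class is a nonzero homogeneous polynomial, its degree is the size of the diagram
    (∃ K : MvPolynomial (Fin n ⊕ Fin n) ℤ,
      (K : MvPowerSeries (Fin n ⊕ Fin n) ℤ) =
        MatrixSchubert.kSeries (MatrixSchubert.matrixSchubertVariety π)) ∧
    MatrixSchubert.matrixSchubertClass π ≠ 0 ∧
    (MatrixSchubert.matrixSchubertClass π).IsHomogeneous (MatrixSchubert.rotheDiagram π).card ∧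
    (MatrixSchubert.matrixSchubertClass π).totalDegree = (MatrixSchubert.rotheDiagram π).card ∧
    -- the size of the diagram is the least length of a permutation with Northwest corner `π`
    IsLeast {l : ℕ | ∃ (m : ℕ) (h : n ≤ m) (ρ : Equiv.Perm (Fin m)),
        MatrixSchubert.HasNWCorner h ρ π ∧ MatrixSchubert.length ρ = l}
      (MatrixSchubert.rotheDiagram π).card := by
  obtain ⟨hne, hhom⟩ := MatrixSchubert.matrixSchubertClass_spec π
  refine ⟨fun t s Z hZ => ?_, MatrixSchubert.tangentSpace_eq_span π, ?_, hne, hhom,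
    hhom.totalDegree hne, MatrixSchubert.isLeast_card_rotheDiagram π⟩
  · rw [MatrixSchubert.mem_tangentSpace_iff] at hZ ⊢
    intro p hp
    rw [Matrix.mul_diagonal, Matrix.diagonal_mul, hZ p hp, mul_zero, zero_mul]
  · obtain ⟨K, hK, -⟩ := MatrixSchubert.exists_kSeries_eq π
    exact ⟨K, hK⟩
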